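/- Let $d\ge 3$ and $1\le k\le d-2$. Let $G(d,q)$ be the Grassmannian of $q$-dimensional linear subspaces of $\mathbb R^d$ and $F(d,q)=\{(u,U): U\in G(d,q),\ u\in U,\ \|u\|=1\}$ the flag manifold, with their usual topologies. Let $\mathcal H^j$ denote $j$-dimensional Hausdorff measure (normalized to agree with Lebesgue measure on $\mathbb R^j$), $\kappa_n$ the volume of the unit ball of $\mathbb R^n$ and $\omega_n=n\kappa_n$ its surface area. For a linear subspace $E$ let $x|E$ be the orthogonal projection of $x$ onto $E$. For linear subspaces $A,B$ of equal dimension, $\langle A,B\rangle^2$ is the squared determinant (with respect to orthonormal bases) of the orthogonal projection $A\to B$. Let $P\subset\mathbb R^d$ be a convex polytope, that is, the convex hull of a non-empty finite set. For $E\in G(d,k)$ let $v_k(P,E)$ be the $k$-dimensional volume of the orthogonal projection $P|E$. Let $\mathcal F_k(P)$ be the set of $k$-dimensional faces of $P$ (including $P$ itself if $\dim P=k$). For $F\in\mathcal F_k(P)$ let $V_k(F)$ be its $k$-dimensional volume, $F^\perp\in G(d,d-k)$ the linear subspace orthogonal to $F$, and $n(P,F)$ the set of unit vectors in the normal cone of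 $P$ at $F$. Define the Borel measure $\tau_k(P,\cdot)$ on $F(d,d-k)$ by $$\tau_k(P,\cdot)=\sum_{F\in\mathcal F_k(P)}V_k(F)\int_{n(P,F)}\mathbf 1\{(u,F^\perp)\in\cdot\}\,\mathcal H^{d-1-k}(du).$$ Then, for every $E\in G(d,k)$, $$v_k(P,E)=\omega_{d-k}^{-1}\int_{F(d,d-k)}\frac{\langle u^\perp\cap U,\,u^\perp\cap E^\perp\rangle^2}{\|u|E^\perp\|^{d-k-2}}\,\tau_k(P,d(u,U)),$$ where the integrand is defined to be $0$ for $u\in E$, and is integrable with respect to $\tau_k(P,\cdot)$. -/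

import Mathlib

open MeasureTheory
open scoped MeasureTheory

noncomputable section

namespace FlagProj

/-- Euclidean space `ℝ^d`. -/
abbrev Euc (d : ℕ) : Type := EuclideanSpace ℝ (Fin d)

/-- A convex polytope: the convex hull of a non-empty finite set of points. -/
def IsPolytope {d : ℕ} (P : Set (Euc d)) : Prop :=
  ∃ S : Finset (Euc d), S.Nonempty ∧ P = convexHull ℝ (S : Set (Euc d))

/-- The Grassmannian `G(d,q)` of `q`-dimensional linear subspaces of `ℝ^d`. -/
def Grass (d q : ℕ) : Type :=
  {U : Submodule ℝ (Euc d) // Module.finrank ℝ U = q}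

/-- The usual topology of `G(d,q)`: a subspace is identified with the orthogonal projection onto it,
and the space of linear operators carries the topology of the operator norm. -/
instance (d q : ℕ) : TopologicalSpace (Grass d q) :=
  TopologicalSpace.induced (fun U : Grass d q => U.1.starProjection) inferInstance

/-- The flag manifold `F(d,q)` of pairs `(u, U)` with `U ∈ G(d,q)` and `u ∈ U` a unit vector. -/
def FlagManifold (d q : ℕ) : Type :=
  {p : Metric.sphere (0 : Euc d) 1 × Grass d q // (p.1 : Euc d) ∈ p.2.1}

/-- `F(d,q)` is topologized as a subspace of `S^{d-1} × G(d,q)`. -/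
instance (d q : ℕ) : TopologicalSpace (FlagManifold d q) :=
  inferInstanceAs (TopologicalSpace
    {p : Metric.sphere (0 : Euc d) 1 × Grass d q // (p.1 : Euc d) ∈ p.2.1})

instance (d q : ℕ) : MeasurableSpace (FlagManifold d q) := borel _

instance (d q : ℕ) : BorelSpace (FlagManifold d q) := ⟨rfl⟩

/-- The unit vector `u` of a flag `(u, U)`. -/
def FlagManifold.vec {d q : ℕ} (x : FlagManifold d q) : Euc d := x.1.1

/-- The subspace `U` of a flag `(u, U)`. -/
def FlagManifold.space {d q : ℕ} (x : FlagManifold d q) : Submodule ℝ (Euc d) := x.1.2.1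

/-- The collection of `k`-dimensional faces of a polytope `P` (every non-empty face of a polytope,
including `P` itself, is the set of maximizers in `P` of some linear functional). -/
def faces {d : ℕ} (k : ℕ) (P : Set (Euc d)) : Set (Set (Euc d)) :=
  {F | F.Nonempty ∧ IsExposed ℝ P F ∧ Module.finrank ℝ (vectorSpan ℝ F) = k}

/-- The normal cone `N(P,F)` of `P` at a face `F`. -/
def normalCone {d : ℕ} (P F : Set (Euc d)) : Set (Euc d) :=
  {u | ∀ x ∈ F, ∀ y ∈ P, inner ℝ u (y - x) ≤ 0}

/-- The spherical image `n(P,F) = N(P,F) ∩ S^{d-1}`. -/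
def sphericalNormals {d : ℕ} (P F : Set (Euc d)) : Set (Euc d) :=
  normalCone P F ∩ Metric.sphere 0 1

/-- `F^⊥ ∈ G(d,d-k)`, the linear subspace orthogonal to a `k`-dimensional set `F`. -/
def perp {d k : ℕ} (F : Set (Euc d)) (hF : Module.finrank ℝ (vectorSpan ℝ F) = k) :
    Grass d (d - k) :=
  ⟨(vectorSpan ℝ F)ᗮ, by
    have h := (vectorSpan ℝ F).finrank_add_finrank_orthogonal
    rw [finrank_euclideanSpace_fin] at h
    omega⟩

theorem mem_perp {d k : ℕ} {P F : Set (Euc d)} (hF : F ∈ faces k P) {u : Euc d}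
    (hu : u ∈ normalCone P F) : u ∈ (perp F hF.2.2).1 := by
  have hsub : F ⊆ P := hF.2.1.subset
  have key : ∀ x ∈ F, ∀ y ∈ F, inner ℝ u (y - x) = 0 := fun x hx y hy => by
    have h1 := hu x hx y (hsub hy)
    have h2 := hu y hy x (hsub hx)
    rw [← neg_sub y x, inner_neg_right] at h2
    linarith
  change u ∈ (vectorSpan ℝ F)ᗮ
  rw [Submodule.mem_orthogonal']
  intro v hv
  refine Submodule.span_induction (p := fun v _ => inner ℝ u v = 0) ?_ ?_ ?_ ?_ hv
  · rintro _ ⟨y, hy, x, hx, rfl⟩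
    exact key x hx y hy
  · simp
  · intro a b _ _ ha hb
    rw [inner_add_right, ha, hb, add_zero]
  · intro c a _ ha
    rw [inner_smul_right, ha, mul_zero]

/-- The map `u ↦ (u, F^⊥)` from `n(P,F)` to `F(d,d-k)`, for a `k`-face `F` of `P`. -/
def flagMap {d k : ℕ} (P : Set (Euc d)) (F : faces k P) (u : sphericalNormals P F.1) :
    FlagManifold d (d - k) :=
  ⟨(⟨u.1, u.2.2⟩, perp F.1 F.2.2.2), mem_perp F.2 u.2.1⟩

theorem measurable_flagMap {d k : ℕ} (P : Set (Euc d)) (F : faces k P) :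
    Measurable (flagMap P F) := by
  refine Continuous.measurable ?_
  refine Continuous.subtype_mk ?_ _
  exact (Continuous.subtype_mk continuous_subtype_val _).prodMk continuous_const

/-- The flag measure `τ_k(P,·)` on `F(d,d-k)`: the sum over all `k`-faces `F` of `P` of
`V_k(F)` times the image of the `(d-1-k)`-dimensional Hausdorff measure on `n(P,F)` under
`u ↦ (u, F^⊥)`. Here `μHE[j]` is the `j`-dimensional Hausdorff measure, normalized so as to agree
with the Lebesgue measure on `j`-dimensional Euclidean spaces. -/
def flagMeasure {d : ℕ} (k : ℕ) (P : Set (Euc d)) : Measure (FlagManifold d (d - k)) :=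
  Measure.sum fun F : faces k P =>
    μHE[k] F.1 •
      (Measure.comap (Subtype.val : sphericalNormals P F.1 → Euc d) μHE[d - 1 - k]).map (flagMap P F)

/-- The `k`-th projection function `v_k(P,E)`: the `k`-dimensional volume of the orthogonal
projection of `P` onto the `k`-dimensional subspace `E`. -/
def projectionFunction {d : ℕ} (k : ℕ) (P : Set (Euc d)) (E : Grass d k) : ℝ :=
  (μHE[k] (E.1.starProjection '' P)).toReal

/-- The orthogonal projection onto `B`, restricted to `A`. -/
def projOnto {d : ℕ} (A B : Submodule ℝ (Euc d)) : A →ₗ[ℝ] B :=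
  B.orthogonalProjectionOnto.toLinearMap ∘ₗ A.subtype

open Classical in
/-- `|⟨A,B⟩|` for linear subspaces of the same dimension: the absolute value of the determinant,
with respect to orthonormal bases of `A` and `B`, of the orthogonal projection `A → B`
(and `0` by convention if the dimensions differ). -/
def absDet {d : ℕ} (A B : Submodule ℝ (Euc d)) : ℝ :=
  if h : Module.finrank ℝ B = Module.finrank ℝ A then
    |(LinearMap.toMatrix (stdOrthonormalBasis ℝ A).toBasis
      ((stdOrthonormalBasis ℝ B).reindex (finCongr h)).toBasis (projOnto A B)).det|
  else 0

/-- The hyperplane `u^⊥`. -/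
def vecPerp {d : ℕ} (u : Euc d) : Submodule ℝ (Euc d) := (Submodule.span ℝ {u})ᗮ

open Classical in
/-- The integrand `⟨u^⊥ ∩ U, u^⊥ ∩ E^⊥⟩² / ‖u|E^⊥‖^(d-k-2)`, set to `0` for `u ∈ E`. -/
def integrand {d k : ℕ} (E : Grass d k) (x : FlagManifold d (d - k)) : ℝ :=
  if x.vec ∈ E.1 then 0
  else absDet (vecPerp x.vec ⊓ x.space) (vecPerp x.vec ⊓ E.1ᗮ) ^ 2 /
    ‖E.1ᗮ.starProjection x.vec‖ ^ (d - k - 2)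

/-- `ω_n = n κ_n`, the surface area of the unit ball of `ℝ^n`, where `κ_n` is its volume. -/
def omega (n : ℕ) : ℝ := n * (volume (Metric.closedBall (0 : Euc n) 1)).toReal

end FlagProj

end

namespace FlagProj

/-! The formula comes from a tiling of `P|E × E^⊥`. For almost every `(x, w)` with `x ∈ P|E` and `w
∈ E^⊥`, maximizing `⟨w, ·⟩` over the fibre of `P` above `x` and applying a supporting hyperplane
gives a normal vector `w + e`, `e ∈ E`, at a point above `x`. Generically the face it supports has
dimension exactly `k` and is unique. So the sets `(F|E) × (N(P,F)|E^⊥)`, with `F` a `k`-face, tile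
`P|E × E^⊥` up to null sets (`volume_projection_mul_volume_ball`). Intersecting the second factor
with the unit ball of `E^⊥` gives `v_k(P,E) κ_{d-k}` as a finite sum over faces.

Let `L` be the direction space of `F` and `D = |⟨L^⊥,E^⊥⟩|`. The first factor has volume `|⟨L,E⟩|
V_k(F)`, and `|⟨L,E⟩| = D` by complementary minors of an orthogonal matrix
(`normDet_projOnto_orthogonal`). In polar coordinates on `L^⊥` the second has volume `D/(d-k)` times
the integral of `‖u|E^⊥‖^{-(d-k)}` over `n(P,F)` when `D ≠ 0`
(`volume_projection_normalCone_inter_ball`); this needs the polar surface measure to be Hausdorff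
measure (`toSphere_eq_euclideanHausdorffMeasure`).

Finally, splitting `u` off the determinant gives `⟨U,E^⊥⟩² / ‖u|E^⊥‖^{d-k}` for the integrand
(`integrand_eq`), which at `U = L^⊥` accounts for both factors `D`. -/

/-! ### Determinants of projections between subspaces. -/

theorem absDet_eq_normDet {d : ℕ} {A B : Submodule ℝ (Euc d)}
    (h : Module.finrank ℝ B = Module.finrank ℝ A) :
    absDet A B = (projOnto A B).normDet := by
  rw [absDet, dif_pos h, LinearMap.normDet_eq_norm_det_toMatrix _ (stdOrthonormalBasis ℝ A)
    ((stdOrthonormalBasis ℝ B).reindex (finCongr h)), Real.norm_eq_abs]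

theorem normDet_projOnto_eq_abs_det {d : ℕ} {ι : Type*} [Fintype ι] [DecidableEq ι]
    {A B : Submodule ℝ (Euc d)} (b : OrthonormalBasis ι ℝ A) (c : OrthonormalBasis ι ℝ B) :
    (projOnto A B).normDet =
      |(Matrix.of fun i j => inner ℝ (c i : Euc d) (b j : Euc d) : Matrix ι ι ℝ).det| := by
  rw [LinearMap.normDet_eq_norm_det_toMatrix _ b c, Real.norm_eq_abs]
  congr 2
  ext i j
  rw [LinearMap.toMatrix_apply, Matrix.of_apply]
  simp only [OrthonormalBasis.coe_toBasis, OrthonormalBasis.coe_toBasis_repr_apply,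
    OrthonormalBasis.repr_apply_apply]
  simp [projOnto]

/-- Orthonormal bases of two orthogonal subspaces of complementary dimension in `A` combine to
an orthonormal basis of `A`. -/
theorem exists_orthonormalBasis_sum {V : Type*} [NormedAddCommGroup V] [InnerProductSpace ℝ V]
    {ι κ : Type*} [Fintype ι] [Fintype κ] {A : Submodule ℝ V} [FiniteDimensional ℝ A]
    {v : ι → V} {w : κ → V} (hv : Orthonormal ℝ v) (hw : Orthonormal ℝ w)
    (hvA : ∀ i, v i ∈ A) (hwA : ∀ i, w i ∈ A) (hvw : ∀ i j, inner ℝ (v i) (w j) = 0)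
    (hcard : Fintype.card ι + Fintype.card κ = Module.finrank ℝ A) :
    ∃ b : OrthonormalBasis (ι ⊕ κ) ℝ A, (∀ i, (b (Sum.inl i) : V) = v i) ∧
      ∀ j, (b (Sum.inr j) : V) = w j := by
  classical
  have hmem : ∀ s : ι ⊕ κ, Sum.elim v w s ∈ A := by rintro (i | j) <;> simp [hvA, hwA]
  have hon : Orthonormal ℝ (fun s : ι ⊕ κ => (⟨Sum.elim v w s, hmem s⟩ : A)) := by
    rw [orthonormal_iff_ite] at hv hw ⊢
    rintro (i | i) (j | j)
    · simpa using hv i j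
    · simpa using hvw i j
    · simpa using (real_inner_comm _ _).trans (hvw j i)
    · simpa using hw i j
  have hsp : ⊤ ≤ Submodule.span ℝ
      (Set.range fun s : ι ⊕ κ => (⟨Sum.elim v w s, hmem s⟩ : A)) := by
    rw [hon.linearIndependent.span_eq_top_of_card_eq_finrank']
    simpa using hcard
  exact ⟨OrthonormalBasis.mk hon hsp, fun i => by simp, fun j => by simp⟩

/-- Complementary diagonal blocks of an orthogonal matrix have the same determinant up to sign. -/
theorem abs_det_eq_of_fromBlocks_mem_unitaryGroup {m n : Type*} [Fintype m] [Fintype n]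
    [DecidableEq m] [DecidableEq n] {A : Matrix m m ℝ} {B : Matrix m n ℝ} {C : Matrix n m ℝ}
    {D : Matrix n n ℝ} (hOu : Matrix.fromBlocks A B C D ∈ Matrix.unitaryGroup (m ⊕ n) ℝ) :
    |D.det| = |A.det| := by
  have hOO := Matrix.mem_unitaryGroup_iff.1 hOu
  have hdet : |(Matrix.fromBlocks A B C D).det| = 1 := by
    have h := Matrix.det_of_mem_unitary hOu
    rw [← Real.norm_eq_abs]
    exact CStarRing.norm_of_mem_unitary h
  rw [Matrix.star_eq_conjTranspose, Matrix.fromBlocks_conjTranspose, Matrix.fromBlocks_multiply,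
    ← Matrix.fromBlocks_one, Matrix.fromBlocks_inj] at hOO
  obtain ⟨h11, -, h21, -⟩ := hOO
  -- The first block column of the transpose of the orthogonal matrix, completed by `(0, 1)`, turns
  -- the product block triangular. Taking determinants compares `det A` with `det D`.
  have hmul : Matrix.fromBlocks A B C D * Matrix.fromBlocks A.conjTranspose 0 B.conjTranspose 1 =
      Matrix.fromBlocks 1 B 0 D := by
    rw [Matrix.fromBlocks_multiply, h11, h21]; simp
  have := congrArg (fun M => |Matrix.det M|) hmul
  simp only [Matrix.det_mul, abs_mul, hdet, one_mul, Matrix.det_fromBlocks_zero₁₂,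
    Matrix.det_fromBlocks_zero₂₁, Matrix.det_one, mul_one, Matrix.conjTranspose_eq_transpose_of_trivial,
    Matrix.det_transpose] at this
  exact this.symm

/-- Complementary minors of an orthogonal matrix: `|⟨L,E⟩| = |⟨L^⊥,E^⊥⟩|`. -/
theorem normDet_projOnto_orthogonal {d : ℕ} {L E : Submodule ℝ (Euc d)}
    (h : Module.finrank ℝ L = Module.finrank ℝ E) :
    (projOnto Lᗮ Eᗮ).normDet = (projOnto L E).normDet := by
  have hL := L.finrank_add_finrank_orthogonal
  have hE := E.finrank_add_finrank_orthogonal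
  have h' : Module.finrank ℝ Lᗮ = Module.finrank ℝ Eᗮ := by omega
  let b₁ := (stdOrthonormalBasis ℝ L).reindex (finCongr h)
  let b₂ := (stdOrthonormalBasis ℝ Lᗮ).reindex (finCongr h')
  let c₁ := stdOrthonormalBasis ℝ E
  let c₂ := stdOrthonormalBasis ℝ Eᗮ
  have key : ∀ (K : Submodule ℝ (Euc d)) {p q : ℕ} (x : OrthonormalBasis (Fin p) ℝ K)
      (y : OrthonormalBasis (Fin q) ℝ Kᗮ), ∃ b : OrthonormalBasis (Fin p ⊕ Fin q) ℝ (Euc d),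
      (∀ i, b (Sum.inl i) = x i) ∧ ∀ j, b (Sum.inr j) = y j := by
    intro K p q x y
    obtain ⟨b, h₁, h₂⟩ := exists_orthonormalBasis_sum (A := (⊤ : Submodule ℝ (Euc d)))
      (v := fun i => (x i : Euc d)) (w := fun i => (y i : Euc d))
      (x.orthonormal.comp_linearIsometry K.subtypeₗᵢ)
      (y.orthonormal.comp_linearIsometry Kᗮ.subtypeₗᵢ) (fun _ => trivial) (fun _ => trivial)
      (fun i j => (y j).2 _ (x i).2) (by
        have := K.finrank_add_finrank_orthogonal
        rw [Module.finrank_eq_card_basis x.toBasis, Module.finrank_eq_card_basis y.toBasis] at this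
        simpa using this)
    exact ⟨b.map (LinearIsometryEquiv.ofTop _ _ rfl), h₁, h₂⟩
  obtain ⟨b, hb₁, hb₂⟩ := key L b₁ b₂
  obtain ⟨c, hc₁, hc₂⟩ := key E c₁ c₂
  rw [normDet_projOnto_eq_abs_det b₁ c₁, normDet_projOnto_eq_abs_det b₂ c₂]
  set A : Matrix _ _ ℝ := Matrix.of fun i j => inner ℝ (c₁ i : Euc d) (b₁ j : Euc d)
  set D : Matrix _ _ ℝ := Matrix.of fun i j => inner ℝ (c₂ i : Euc d) (b₂ j : Euc d)
  set B : Matrix _ _ ℝ := Matrix.of fun i j => inner ℝ (c₁ i : Euc d) (b₂ j : Euc d)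
  set C : Matrix _ _ ℝ := Matrix.of fun i j => inner ℝ (c₂ i : Euc d) (b₁ j : Euc d)
  set O : Matrix _ _ ℝ := Matrix.fromBlocks A B C D
  have hO : O = c.toBasis.toMatrix b := by
    ext i j
    rw [Module.Basis.toMatrix_apply, OrthonormalBasis.coe_toBasis_repr_apply,
      OrthonormalBasis.repr_apply_apply]
    rcases i with i | i <;> rcases j with j | j <;> simp [O, A, B, C, D, hb₁, hb₂, hc₁, hc₂]
  have hOu : O ∈ Matrix.unitaryGroup _ ℝ := by
    rw [hO]; exact c.toMatrix_orthonormalBasis_mem_unitary b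
  exact abs_det_eq_of_fromBlocks_mem_unitaryGroup hOu

theorem mem_vecPerp {d : ℕ} {u v : Euc d} : v ∈ vecPerp u ↔ inner ℝ u v = 0 :=
  Submodule.mem_orthogonal_singleton_iff_inner_right

theorem finrank_vecPerp_inf {d : ℕ} {A : Submodule ℝ (Euc d)} {u : Euc d} (hu : u ∈ A)
    (h0 : u ≠ 0) : Module.finrank ℝ (vecPerp u ⊓ A : Submodule ℝ (Euc d)) + 1 =
      Module.finrank ℝ A := by
  have := Submodule.finrank_add_inf_finrank_orthogonal
    (Submodule.span_le.2 (Set.singleton_subset_iff.2 hu) : Submodule.span ℝ {u} ≤ A)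
  rw [finrank_span_singleton h0] at this
  rw [← this, add_comm]
  rfl

/-- Splitting off the unit vector `u` from the determinant of the projection `A → B`. -/
theorem normDet_projOnto_vecPerp {d : ℕ} {A B : Submodule ℝ (Euc d)}
    (h : Module.finrank ℝ B = Module.finrank ℝ A) {u : Euc d} (hu : u ∈ A) (h1 : ‖u‖ = 1)
    (hT : B.starProjection u ≠ 0) :
    absDet (vecPerp u ⊓ A) (vecPerp u ⊓ B) = (projOnto A B).normDet / ‖B.starProjection u‖ := by
  have hu0 : u ≠ 0 := by rintro rfl; simp at h1
  set p := B.starProjection u with hp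
  have hpB : p ∈ B := B.starProjection_apply_mem u
  have hn : ‖p‖ ≠ 0 := norm_ne_zero_iff.2 hT
  have hin : ∀ v ∈ B, inner ℝ v u = inner ℝ v p := by
    intro v hv
    rw [hp, ← Submodule.inner_starProjection_left_eq_right,
      Submodule.starProjection_eq_self_iff.2 hv]
  -- On `B`, pairing with `u` equals pairing with its projection `p`, so `p/‖p‖` completes a basis
  -- of `u^⊥ ∩ B` to one of `B`.
  have hBeq : vecPerp u ⊓ B = vecPerp p ⊓ B := by
    ext v
    simp only [Submodule.mem_inf, mem_vecPerp]
    refine and_congr_left fun hv => ?_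
    rw [real_inner_comm, hin v hv, real_inner_comm]
  have e1 := finrank_vecPerp_inf hu hu0
  have e2 := finrank_vecPerp_inf hpB hT
  rw [hBeq]
  have e3 : Module.finrank ℝ (vecPerp p ⊓ B : Submodule ℝ (Euc d)) =
      Module.finrank ℝ (vecPerp u ⊓ A : Submodule ℝ (Euc d)) := by omega
  rw [absDet_eq_normDet e3]
  let b' := stdOrthonormalBasis ℝ (vecPerp u ⊓ A : Submodule ℝ (Euc d))
  let c' := (stdOrthonormalBasis ℝ (vecPerp p ⊓ B : Submodule ℝ (Euc d))).reindex (finCongr e3)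
  obtain ⟨b, hb₁, hb₂⟩ := exists_orthonormalBasis_sum (A := A) (v := fun _ : Unit => u)
    (w := fun i => (b' i : Euc d)) (by simp [h1])
    (b'.orthonormal.comp_linearIsometry (Submodule.subtypeₗᵢ _)) (fun _ => hu)
    (fun i => (b' i).2.2) (fun _ i => mem_vecPerp.1 (b' i).2.1) (by simp; omega)
  obtain ⟨c, hc₁, hc₂⟩ := exists_orthonormalBasis_sum (A := B)
    (v := fun _ : Unit => (‖p‖⁻¹ • p))
    (w := fun i => (c' i : Euc d)) (by simp [norm_smul, hn])
    (c'.orthonormal.comp_linearIsometry (Submodule.subtypeₗᵢ _)) (fun _ => B.smul_mem _ hpB)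
    (fun i => (c' i).2.2) (fun _ i => by
      rw [inner_smul_left, mem_vecPerp.1 (c' i).2.1, mul_zero]) (by simp; omega)
  rw [normDet_projOnto_eq_abs_det b c, normDet_projOnto_eq_abs_det b' c']
  -- The lower left block vanishes because the vectors `c'` are orthogonal to `u`; the corner is
  -- `⟨p/‖p‖, u⟩ = ‖p‖`.
  have hblock : (Matrix.of fun i j => inner ℝ (c i : Euc d) (b j : Euc d) : Matrix _ _ ℝ) =
      Matrix.fromBlocks (Matrix.of fun _ _ => ‖p‖)
        (Matrix.of fun _ j => inner ℝ (‖p‖⁻¹ • p) (b' j : Euc d)) 0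
        (Matrix.of fun i j => inner ℝ (c' i : Euc d) (b' j : Euc d)) := by
    ext i j
    rcases i with i | i <;> rcases j with j | j
    · simp only [Matrix.of_apply, hc₁, hb₁, Matrix.fromBlocks_apply₁₁]
      rw [hin _ (B.smul_mem _ hpB), inner_smul_left, real_inner_self_eq_norm_sq]
      simp; field_simp
    · simp [hc₁, hb₂]
    · simp only [Matrix.of_apply, hc₂, hb₁, Matrix.fromBlocks_apply₂₁, Matrix.zero_apply]
      rw [hin _ (c' i).2.2, real_inner_comm, mem_vecPerp.1 (c' i).2.1]
    · simp [hc₂, hb₂]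
  rw [hblock, Matrix.det_fromBlocks_zero₂₁, abs_mul]
  simp [hn]

/-! ### Surface measure on the sphere as Hausdorff measure. -/

open Set Metric Measure
open scoped ENNReal NNReal Pointwise

/-- If `f` expands distances at most by a factor `K` relative to `g`, then the Hausdorff measure
of the image of `f` is controlled by that of the image of `g`. -/
theorem euclideanHausdorffMeasure_image_le {ι X Y : Type*} [EMetricSpace X] [MeasurableSpace X]
    [BorelSpace X] [EMetricSpace Y] [MeasurableSpace Y] [BorelSpace Y] (n : ℕ) {f : ι → X}
    {g : ι → Y} {s : Set ι} {K : ℝ≥0}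
    (h : ∀ x ∈ s, ∀ y ∈ s, edist (f x) (f y) ≤ K * edist (g x) (g y)) :
    μHE[n] (f '' s) ≤ (K : ℝ≥0∞) ^ n * μHE[n] (g '' s) := by
  rcases s.eq_empty_or_nonempty with rfl | ⟨x₀, -⟩
  · simp
  have : Nonempty ι := ⟨x₀⟩
  have hsec : ∀ y ∈ g '' s, ∃ x ∈ s, g x = y := fun y hy => hy
  -- `g` may fail to be injective, but the hypothesis forces `f` to agree at points with the same
  -- `g`-value, so `f` factors through any section of `g`.
  choose! σ hσs hσ using hsec
  have hL : LipschitzOnWith K (f ∘ σ) (g '' s) := by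
    intro y hy z hz
    have := h _ (hσs y hy) _ (hσs z hz)
    rwa [hσ y hy, hσ z hz] at this
  have himg : f '' s = (f ∘ σ) '' (g '' s) := by
    rw [image_image]
    refine image_congr fun x hx => ?_
    have := h x hx _ (hσs _ (mem_image_of_mem g hx))
    rw [hσ _ (mem_image_of_mem g hx), edist_self, mul_zero] at this
    exact edist_le_zero.1 this
  have := hL.hausdorffMeasure_image_le (d := n) (by positivity)
  rw [← himg, ENNReal.rpow_natCast] at this
  simp only [euclideanHausdorffMeasure_def, Measure.smul_apply, nnreal_smul_coe_apply]
  rw [mul_left_comm]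
  gcongr

section Sphere

variable {V : Type*} [NormedAddCommGroup V] [InnerProductSpace ℝ V]

/-- This form of the law of cosines separates radial and angular distance, so that a thin cone shell
can be compared with a cylinder. -/
theorem norm_smul_sub_smul_sq {a b : V} (ha : ‖a‖ = 1) (hb : ‖b‖ = 1) (r s : ℝ) :
    ‖r • a - s • b‖ ^ 2 = (r - s) ^ 2 + r * s * ‖a - b‖ ^ 2 := by
  rw [norm_sub_sq_real, norm_sub_sq_real, norm_smul, norm_smul, inner_smul_left, inner_smul_right,
    ha, hb]
  simp only [Real.norm_eq_abs, mul_one, sq_abs, conj_trivial]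
  ring

/-- On a cap of radius `δ` about `p`, the projection of the sphere to `p^⊥` contracts distances at
most by the factor `√(1 - δ²)`. -/
theorem norm_sub_sq_le_of_mem_cap {p a b : V} {H : Submodule ℝ V}
    [H.HasOrthogonalProjection] (hH : H = (ℝ ∙ p)ᗮ) (hp : ‖p‖ = 1) (ha : ‖a‖ = 1) (hb : ‖b‖ = 1) {δ : ℝ}
    (hap : ‖a - p‖ ≤ δ) (hbp : ‖b - p‖ ≤ δ) :
    (1 - δ ^ 2) * ‖a - b‖ ^ 2 ≤ ‖H.orthogonalProjectionOnto (a - b)‖ ^ 2 := by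
  subst hH
  have h1 := Submodule.norm_sq_eq_add_norm_sq_projection (a - b) (ℝ ∙ p)
  have h2 : ‖(ℝ ∙ p).orthogonalProjectionOnto (a - b)‖ = |inner ℝ p (a - b)| := by
    change ‖((ℝ ∙ p).orthogonalProjectionOnto (a - b) : V)‖ = _
    rw [← Submodule.starProjection_apply,
      Submodule.starProjection_unit_singleton ℝ hp, norm_smul, hp, mul_one, Real.norm_eq_abs]
  -- The chord `a - b` is orthogonal to the midpoint of `a` and `b`, so `p` may be replaced by its
  -- difference from the midpoint, which has norm at most `δ`.
  have h0 : inner ℝ (a + b) (a - b) = (0 : ℝ) := by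
    rw [inner_add_left, inner_sub_right, inner_sub_right, real_inner_self_eq_norm_sq,
      real_inner_self_eq_norm_sq, ha, hb, real_inner_comm]; ring
  have h3 : inner ℝ p (a - b) = inner ℝ (p - (1 / 2 : ℝ) • (a + b)) (a - b) := by
    rw [inner_sub_left, inner_smul_left, h0]; simp
  have h4 : ‖p - (1 / 2 : ℝ) • (a + b)‖ ≤ δ := by
    have : p - (1 / 2 : ℝ) • (a + b) = -((1 / 2 : ℝ) • (a - p) + (1 / 2 : ℝ) • (b - p)) := by
      module
    rw [this, norm_neg]
    refine (norm_add_le _ _).trans ?_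
    rw [norm_smul, norm_smul]
    norm_num
    linarith
  have h5 : |inner ℝ p (a - b)| ≤ δ * ‖a - b‖ := by
    rw [h3]
    exact (abs_real_inner_le_norm _ _).trans (by gcongr)
  have h6 : |inner ℝ p (a - b)| ^ 2 ≤ (δ * ‖a - b‖) ^ 2 := by gcongr
  rw [mul_pow] at h6
  rw [h2] at h1
  linarith

variable [FiniteDimensional ℝ V] [MeasurableSpace V] [BorelSpace V]

/-- The volume of the part of a cone between two concentric spheres. -/
theorem volume_Ico_smul {n : ℕ} (hV : Module.finrank ℝ V = n + 1) {t : ℝ}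
    (A : Set (sphere (0 : V) 1)) (hA : MeasurableSet A) :
    volume (Ico 1 t • ((↑) '' A : Set V)) = volume.toSphere A *
      ∫⁻ r in Ico 1 t, ENNReal.ofReal (r ^ n) := by
  let I : Set (Ioi (0 : ℝ)) := {r | (r : ℝ) ∈ Ico 1 t}
  have hI : MeasurableSet I := measurable_subtype_coe measurableSet_Ico
  have hset : Ico 1 t • ((↑) '' A : Set V) =
      (↑) '' (homeomorphUnitSphereProd V ⁻¹' (A ×ˢ I)) := by
    rw [← Homeomorph.image_symm, image_image]
    ext x
    constructor
    · rintro ⟨r, hr, _, ⟨a, ha, rfl⟩, rfl⟩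
      exact ⟨(a, ⟨r, zero_lt_one.trans_le hr.1⟩), ⟨ha, hr⟩, by simp⟩
    · rintro ⟨⟨a, r⟩, ⟨ha, hr⟩, rfl⟩
      exact ⟨r, hr, a, ⟨a, ha, rfl⟩, by simp⟩
  rw [hset, ← comap_subtype_coe_apply (measurableSet_singleton _).compl,
    (measurePreserving_homeomorphUnitSphereProd volume).measure_preimage
      (hA.prod hI).nullMeasurableSet, prod_prod, hV, volumeIoiPow, withDensity_apply _ hI,
    setLIntegral_subtype measurableSet_Ioi _ fun a : ℝ => .ofReal (a ^ (n + 1 - 1))]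
  congr 3
  have : (Subtype.val '' I : Set ℝ) = Ico 1 t := by
    ext r
    constructor
    · rintro ⟨r, hr, rfl⟩; exact hr
    · intro hr; exact ⟨⟨r, zero_lt_one.trans_le hr.1⟩, hr, rfl⟩
  rw [this]

/-- The density `r^n` lies between `1` and `t^n` on the shell. -/
theorem volume_Ico_smul_bounds {n : ℕ} (hV : Module.finrank ℝ V = n + 1) {t : ℝ} (ht : 1 ≤ t)
    (A : Set (sphere (0 : V) 1)) (hA : MeasurableSet A) :
    volume.toSphere A * ENNReal.ofReal (t - 1) ≤ volume (Ico 1 t • ((↑) '' A : Set V)) ∧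
    volume (Ico 1 t • ((↑) '' A : Set V)) ≤
      volume.toSphere A * (ENNReal.ofReal t ^ n * ENNReal.ofReal (t - 1)) := by
  rw [volume_Ico_smul hV A hA]
  constructor
  · gcongr
    calc ENNReal.ofReal (t - 1) = ∫⁻ r in Ico 1 t, 1 := by simp
      _ ≤ _ := setLIntegral_mono' measurableSet_Ico fun r hr => by
        rw [ENNReal.one_le_ofReal]; exact one_le_pow₀ hr.1
  · gcongr
    calc ∫⁻ r in Ico 1 t, ENNReal.ofReal (r ^ n) ≤ ∫⁻ r in Ico 1 t, ENNReal.ofReal t ^ n :=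
          setLIntegral_mono' measurableSet_Ico fun r hr => by
            rw [← ENNReal.ofReal_pow (by linarith)]
            exact ENNReal.ofReal_le_ofReal (pow_le_pow_left₀ (by linarith [hr.1]) hr.2.le _)
      _ = _ := by simp

/-- On a small cap, the surface measure `toSphere` and the Hausdorff measure almost agree. -/
theorem toSphere_hausdorff_cap {n : ℕ} (hV : Module.finrank ℝ V = n + 1) {t : ℝ} (ht : 1 < t)
    {δ : ℝ} (hδ : 1 ≤ t ^ 2 * (1 - δ ^ 2)) (p : sphere (0 : V) 1)
    (A : Set (sphere (0 : V) 1)) (hA : MeasurableSet A) (hAp : ∀ a ∈ A, ‖(a : V) - p‖ ≤ δ) :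
    volume.toSphere A ≤ ENNReal.ofReal t ^ (2 * n + 2) * μHE[n] A ∧
      μHE[n] A ≤ ENNReal.ofReal t ^ (2 * n + 2) * volume.toSphere A := by
  have ht0 : 0 ≤ t := by linarith
  have hp : ‖(p : V)‖ = 1 := by simp
  have hp0 : (p : V) ≠ 0 := by rintro h; simp [h] at hp
  obtain ⟨H, hH⟩ : ∃ H : Submodule ℝ V, H = (ℝ ∙ (p : V))ᗮ := ⟨_, rfl⟩
  have hHdim : Module.finrank ℝ H = n := by
    have := (ℝ ∙ (p : V)).finrank_add_finrank_orthogonal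
    rw [finrank_span_singleton hp0, ← hH] at this
    omega
  let π : sphere (0 : V) 1 → H := fun a => H.orthogonalProjectionOnto (a : V)
  have hπ : ∀ a b : sphere (0 : V) 1,
      π a - π b = H.orthogonalProjectionOnto ((a : V) - b) := fun a b => (map_sub _ _ _).symm
  have hπle : ∀ a b : sphere (0 : V) 1, ‖π a - π b‖ ≤ ‖(a : V) - b‖ := fun a b => by
    rw [hπ]; exact H.norm_orthogonalProjectionOnto_apply_le _
  have hπge : ∀ a ∈ A, ∀ b ∈ A, ‖(a : V) - b‖ ≤ t * ‖π a - π b‖ := by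
    intro a ha b hb
    have h := norm_sub_sq_le_of_mem_cap (p := (p : V)) (a := a) (b := b) hH hp (by simp) (by simp)
      (hAp a ha) (hAp b hb)
    rw [← hπ] at h
    refine abs_le_of_sq_le_sq' ?_ (by positivity) |>.2
    rw [mul_pow]
    calc ‖(a : V) - b‖ ^ 2 ≤ (t ^ 2 * (1 - δ ^ 2)) * ‖(a : V) - b‖ ^ 2 :=
          le_mul_of_one_le_left (by positivity) hδ
      _ = t ^ 2 * ((1 - δ ^ 2) * ‖(a : V) - b‖ ^ 2) := by ring
      _ ≤ _ := by gcongr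
  -- Two images of `A × [1, t)`: the cone shell in `V`, measured by the surface measure, and the
  -- cylinder over the projected cap in `H × ℝ`, measured by Hausdorff measure times length.
  let q : sphere (0 : V) 1 × ℝ → V := fun x => x.2 • (x.1 : V)
  let f : sphere (0 : V) 1 × ℝ → WithLp 2 (H × ℝ) := fun x => WithLp.toLp 2 (π x.1, x.2)
  have hf : ∀ x y, ‖f x - f y‖ ^ 2 = ‖π x.1 - π y.1‖ ^ 2 + (x.2 - y.2) ^ 2 := by
    intro x y
    rw [WithLp.prod_norm_sq_eq_of_L2]
    simp [f]
  have hq : ∀ x y, ‖q x - q y‖ ^ 2 = (x.2 - y.2) ^ 2 + x.2 * y.2 * ‖(x.1 : V) - y.1‖ ^ 2 :=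
    fun x y => norm_smul_sub_smul_sq (by simp) (by simp) _ _
  have hdim' : Module.finrank ℝ (WithLp 2 (H × ℝ)) = n + 1 := by
    rw [(WithLp.linearEquiv 2 ℝ (H × ℝ)).finrank_eq, Module.finrank_prod, hHdim,
      Module.finrank_self]
  have hvolf : μHE[n + 1] (f '' (A ×ˢ Ico 1 t)) =
      μHE[n] (π '' A) * ENNReal.ofReal (t - 1) := by
    have h1 : f '' (A ×ˢ Ico 1 t) = WithLp.ofLp ⁻¹' ((π '' A) ×ˢ Ico 1 t) := by
      ext z
      constructor
      · rintro ⟨x, hx, rfl⟩; exact ⟨⟨x.1, hx.1, rfl⟩, hx.2⟩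
      · rintro ⟨⟨a, ha, hz⟩, hr⟩
        exact ⟨(a, (WithLp.ofLp z).2), ⟨ha, hr⟩, by simp only [f]; rw [hz]⟩
    have h2 : (μHE[n + 1] : Measure (WithLp 2 (H × ℝ))) = volume := by
      rw [← hdim', InnerProductSpace.euclideanHausdorffMeasure_eq_volume]
    have h3 : (μHE[n] : Measure H) = volume := by
      rw [← InnerProductSpace.euclideanHausdorffMeasure_eq_volume, hHdim]
    rw [h1, h2, h3]
    have := (WithLp.volume_preserving_ofLp H ℝ).measure_preimage_equiv
      (f := (MeasurableEquiv.toLp 2 (H × ℝ)).symm) ((π '' A) ×ˢ Ico 1 t)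
    refine this.trans ?_
    rw [volume_eq_prod, prod_prod]
    simp
  have hvolq : μHE[n + 1] (q '' (A ×ˢ Ico 1 t)) = volume (Ico 1 t • ((↑) '' A : Set V)) := by
    rw [← hV, InnerProductSpace.euclideanHausdorffMeasure_eq_volume]
    congr 1
    ext z
    constructor
    · rintro ⟨x, hx, rfl⟩; exact ⟨x.2, hx.2, x.1, ⟨x.1, hx.1, rfl⟩, rfl⟩
    · rintro ⟨r, hr, _, ⟨a, ha, rfl⟩, rfl⟩; exact ⟨(a, r), ⟨ha, hr⟩, rfl⟩
  have hed : ∀ {X Y : Type _} [NormedAddCommGroup X] [NormedAddCommGroup Y] {x y : X} {x' y' : Y}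
      {K : ℝ}, 0 ≤ K → ‖x - y‖ ≤ K * ‖x' - y'‖ →
      edist x y ≤ (K.toNNReal : ℝ≥0∞) * edist x' y' := by
    intro X Y _ _ x y x' y' K hK h
    rw [edist_dist, edist_dist, dist_eq_norm, dist_eq_norm]
    change _ ≤ ENNReal.ofReal K * _
    rw [← ENNReal.ofReal_mul hK]
    exact ENNReal.ofReal_le_ofReal h
  have i1 : μHE[n + 1] (f '' (A ×ˢ Ico 1 t)) ≤ μHE[n + 1] (q '' (A ×ˢ Ico 1 t)) := by
    have := euclideanHausdorffMeasure_image_le (n + 1) (f := f) (g := q) (s := A ×ˢ Ico 1 t)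
      (K := (1 : ℝ).toNNReal) (fun x hx y hy => hed zero_le_one (by
        rw [one_mul]
        refine abs_le_of_sq_le_sq' ?_ (by positivity) |>.2
        rw [hf, hq, add_comm]
        gcongr
        calc ‖π x.1 - π y.1‖ ^ 2 ≤ ‖(x.1 : V) - y.1‖ ^ 2 := by gcongr; exact hπle _ _
          _ ≤ _ := le_mul_of_one_le_left (by positivity)
            (one_le_mul_of_one_le_of_one_le hx.2.1 hy.2.1)))
    simpa using this
  -- The Lipschitz constant is `t²`: one factor from the radii, which are below `t`, and one from
  -- inverting the projection of the cap. Its power `n + 1` gives the exponent `2n + 2`.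
  have i2 : μHE[n + 1] (q '' (A ×ˢ Ico 1 t)) ≤
      ENNReal.ofReal t ^ (2 * n + 2) * μHE[n + 1] (f '' (A ×ˢ Ico 1 t)) := by
    have := euclideanHausdorffMeasure_image_le (n + 1) (f := q) (g := f) (s := A ×ˢ Ico 1 t)
      (K := (t ^ 2).toNNReal) (fun x hx y hy => hed (by positivity) (by
        refine abs_le_of_sq_le_sq' ?_ (by positivity) |>.2
        rw [mul_pow, hf, hq, mul_add, add_comm]
        have hx2 := hx.2
        have hy2 := hy.2
        have hx0 : 0 ≤ x.2 := zero_le_one.trans hx2.1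
        refine add_le_add ?_ ?_
        · calc x.2 * y.2 * ‖(x.1 : V) - y.1‖ ^ 2 ≤ t * t * (t * ‖π x.1 - π y.1‖) ^ 2 := by
                have := hπge _ hx.1 _ hy.1
                have := hx2.2.le
                have := hy2.2.le
                have : 0 ≤ y.2 := zero_le_one.trans hy2.1
                gcongr
            _ = _ := by ring
        · exact le_mul_of_one_le_left (sq_nonneg _) (one_le_pow₀ (one_le_pow₀ ht.le))))
    refine this.trans (le_of_eq ?_)
    congr 1
    change ENNReal.ofReal (t ^ 2) ^ (n + 1) = _
    rw [ENNReal.ofReal_pow ht0, ← pow_mul]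
    ring
  have i3 : μHE[n] (π '' A) ≤ μHE[n] A := by
    have := euclideanHausdorffMeasure_image_le n (f := π) (g := id) (s := A)
      (K := (1 : ℝ).toNNReal) (fun x hx y hy => by
        have := hed (x := π x) (y := π y) (x' := (x : V)) (y' := y) zero_le_one
          (by rw [one_mul]; exact hπle x y)
        exact this)
    simpa using this
  have i4 : μHE[n] A ≤ ENNReal.ofReal t ^ n * μHE[n] (π '' A) := by
    have := euclideanHausdorffMeasure_image_le n (f := id) (g := π) (s := A)
      (K := t.toNNReal) (fun x hx y hy => by
        have := hed (x := (x : V)) (y := y) (x' := π x) (y' := π y) ht0 (hπge x hx y hy)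
        exact this)
    rw [image_id] at this
    exact this
  obtain ⟨j1, j2⟩ := volume_Ico_smul_bounds hV ht.le A hA
  rw [hvolf, hvolq] at i1 i2
  -- Shell and cylinder both have thickness `t - 1`, which is cancelled.
  have hc0 : ENNReal.ofReal (t - 1) ≠ 0 := by simpa using ht
  have hct : ENNReal.ofReal (t - 1) ≠ ∞ := ENNReal.ofReal_ne_top
  constructor
  · refine (ENNReal.mul_le_mul_iff_left hc0 hct).1 (j1.trans (i2.trans ?_))
    rw [← mul_assoc]
    gcongr
  · have k1 : μHE[n] (π '' A) ≤ volume.toSphere A * ENNReal.ofReal t ^ n := by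
      refine (ENNReal.mul_le_mul_iff_left hc0 hct).1 (i1.trans (j2.trans ?_))
      rw [mul_assoc]
    calc μHE[n] A ≤ ENNReal.ofReal t ^ n * (volume.toSphere A * ENNReal.ofReal t ^ n) :=
          i4.trans (by gcongr)
      _ = ENNReal.ofReal t ^ (2 * n) * volume.toSphere A := by ring
      _ ≤ _ := by
        gcongr
        · simpa using ht.le
        · omega

/-- Disjointing the cover and adding up the pieces globalizes the estimates on caps. -/
theorem measure_le_of_iUnion {α ι : Type*} [MeasurableSpace α] [Countable ι] {μ ν : Measure α}
    {c : ι → Set α} (hc : ∀ i, MeasurableSet (c i)) (hcov : ⋃ i, c i = univ)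
    (h : ∀ i, ∀ A ⊆ c i, MeasurableSet A → μ A ≤ ν A) {A : Set α} (hA : MeasurableSet A) :
    μ A ≤ ν A := by
  rcases isEmpty_or_nonempty ι with hι | hι
  · have : A = ∅ := by
      rw [iUnion_of_empty] at hcov
      exact subset_empty_iff.1 (hcov ▸ subset_univ A)
    simp [this]
  obtain ⟨e, he⟩ := exists_surjective_nat ι
  let D := disjointed (c ∘ e)
  have hD : ∀ i, MeasurableSet (D i) := MeasurableSet.disjointed fun i => hc _
  have hDu : ⋃ i, D i = univ := by
    rw [iUnion_disjointed, ← hcov]; exact he.iUnion_comp c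
  have hAu : A = ⋃ i, A ∩ D i := by rw [← inter_iUnion, hDu, inter_univ]
  have hdis : Pairwise (Function.onFun Disjoint fun i => A ∩ D i) := fun i j hij =>
    (disjoint_disjointed (c ∘ e) hij).mono inter_subset_right inter_subset_right
  rw [hAu, measure_iUnion hdis fun i => hA.inter (hD i),
    measure_iUnion hdis fun i => hA.inter (hD i)]
  exact ENNReal.tsum_le_tsum fun i =>
    h (e i) _ (inter_subset_right.trans (disjointed_subset _ _)) (hA.inter (hD i))

/-- The surface measure on the unit sphere of an `(n+1)`-dimensional Euclidean space is the
`n`-dimensional Hausdorff measure. -/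
theorem toSphere_eq_euclideanHausdorffMeasure {n : ℕ} (hV : Module.finrank ℝ V = n + 1) :
    (volume : Measure V).toSphere = μHE[n] := by
  have main : ∀ t : ℝ, 1 < t → ∀ A : Set (sphere (0 : V) 1), MeasurableSet A →
      volume.toSphere A ≤ ENNReal.ofReal t ^ (2 * n + 2) * μHE[n] A ∧
      μHE[n] A ≤ ENNReal.ofReal t ^ (2 * n + 2) * volume.toSphere A := by
    intro t ht A hA
    obtain ⟨δ, hδ0, hδ⟩ : ∃ δ : ℝ, 0 < δ ∧ 1 ≤ t ^ 2 * (1 - δ ^ 2) := by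
      -- This `δ` solves `t²(1 - δ²) = 1`.
      refine ⟨Real.sqrt (1 - (t ^ 2)⁻¹), Real.sqrt_pos.2 ?_, ?_⟩
      · rw [sub_pos]; exact inv_lt_one_of_one_lt₀ (one_lt_pow₀ ht two_ne_zero)
      · rw [Real.sq_sqrt]
        · rw [sub_sub_cancel, mul_inv_cancel₀ (by positivity)]
        · rw [sub_nonneg]; exact inv_le_one_of_one_le₀ (one_le_pow₀ ht.le)
    obtain ⟨s, hs, hcov⟩ := TopologicalSpace.countable_cover_nhds
      (f := fun p : sphere (0 : V) 1 => closedBall p δ) fun p => closedBall_mem_nhds _ hδ0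
    have := hs.to_subtype
    rw [biUnion_eq_iUnion] at hcov
    have hmem : ∀ (p : s), ∀ B ⊆ closedBall (p : sphere (0 : V) 1) δ, ∀ a ∈ B,
        ‖(a : V) - (p : sphere (0 : V) 1)‖ ≤ δ := fun p B hB a ha => by
      rw [← dist_eq_norm]; exact hB ha
    constructor
    · exact measure_le_of_iUnion (ν := ENNReal.ofReal t ^ (2 * n + 2) • μHE[n])
        (fun _ => measurableSet_closedBall) hcov
        (fun p B hB hBm => (toSphere_hausdorff_cap hV ht hδ p B hBm (hmem p B hB)).1) hA
    · exact measure_le_of_iUnion (ν := ENNReal.ofReal t ^ (2 * n + 2) • volume.toSphere)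
        (fun _ => measurableSet_closedBall) hcov
        (fun p B hB hBm => (toSphere_hausdorff_cap hV ht hδ p B hBm (hmem p B hB)).2) hA
  -- As `t ↓ 1` the distortion factor tends to `1`, and the two inequalities become an equality.
  have hlim : ∀ x : ℝ≥0∞, Filter.Tendsto (fun t : ℝ => ENNReal.ofReal t ^ (2 * n + 2) * x)
      (nhdsWithin 1 (Ioi 1)) (nhds x) := by
    intro x
    have h1 : Filter.Tendsto (fun t : ℝ => ENNReal.ofReal t ^ (2 * n + 2))
        (nhdsWithin 1 (Ioi 1)) (nhds 1) := by
      have : Continuous fun t : ℝ => ENNReal.ofReal t ^ (2 * n + 2) :=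
        (ENNReal.continuous_pow _).comp ENNReal.continuous_ofReal
      simpa using (this.tendsto 1).mono_left nhdsWithin_le_nhds
    simpa using ENNReal.Tendsto.mul_const (b := x) h1 (Or.inl one_ne_zero)
  ext A hA
  refine le_antisymm (ge_of_tendsto (hlim _) ?_) (ge_of_tendsto (hlim _) ?_)
  · filter_upwards [self_mem_nhdsWithin] with t ht using (main t ht A hA).1
  · filter_upwards [self_mem_nhdsWithin] with t ht using (main t ht A hA).2

end Sphere

/-! ### Polar coordinates on a cone. -/

/-- Volume of the part of a cone where `‖T x‖ < 1`, in polar coordinates. -/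
theorem volume_cone_inter_norm_lt_one {V W : Type*} [NormedAddCommGroup V] [InnerProductSpace ℝ V]
    [FiniteDimensional ℝ V] [MeasurableSpace V] [BorelSpace V]
    [NormedAddCommGroup W] [NormedSpace ℝ W] {n : ℕ} (hV : Module.finrank ℝ V = n + 1)
    {C : Set V} (hC : MeasurableSet C) (hcone : ∀ r : ℝ, 0 < r → ∀ x ∈ C, r • x ∈ C)
    (T : V →L[ℝ] W) (hT : Function.Injective T) :
    volume (C ∩ {x | ‖T x‖ < 1}) = ∫⁻ u in {u : sphere (0 : V) 1 | (u : V) ∈ C},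
      ENNReal.ofReal (‖T u‖⁻¹ ^ (n + 1) / (n + 1)) ∂μHE[n] := by
  have hfin : Nontrivial V := Module.nontrivial_of_finrank_pos (R := ℝ) (by omega)
  set X := C ∩ {x | ‖T x‖ < 1} with hXdef
  have hX : MeasurableSet X :=
    hC.inter (isOpen_lt (by fun_prop) continuous_const).measurableSet
  have hCs : MeasurableSet {u : sphere (0 : V) 1 | (u : V) ∈ C} := measurable_subtype_coe hC
  let Y : Set (sphere (0 : V) 1 × Ioi (0 : ℝ)) := {y | (y.2 : ℝ) • (y.1 : V) ∈ X}
  have hY : MeasurableSet Y := by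
    refine measurableSet_preimage (f := fun y : sphere (0 : V) 1 × Ioi (0 : ℝ) =>
      (y.2 : ℝ) • (y.1 : V)) ?_ hX
    exact (Continuous.smul (by fun_prop) (by fun_prop)).measurable
  have h0 : volume X = volume (X \ {0}) := (measure_sdiff_null (measure_singleton _)).symm
  have h1 : X \ {0} = (↑) '' (homeomorphUnitSphereProd V ⁻¹' Y) := by
    rw [← Homeomorph.image_symm, image_image]
    ext x
    constructor
    · rintro ⟨hx, hx0⟩
      refine ⟨homeomorphUnitSphereProd V ⟨x, hx0⟩, ?_, by simp⟩
      have hne : ‖x‖ ≠ 0 := norm_ne_zero_iff.2 hx0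
      change _ • _ ∈ X
      simpa [smul_smul, hne] using hx
    · rintro ⟨⟨u, r⟩, hy, rfl⟩
      refine ⟨hy, ?_⟩
      exact ((homeomorphUnitSphereProd V).symm (u, r)).2
  rw [h0, h1, ← comap_subtype_coe_apply (measurableSet_singleton _).compl,
    (measurePreserving_homeomorphUnitSphereProd volume).measure_preimage hY.nullMeasurableSet,
    prod_apply hY, hV, toSphere_eq_euclideanHausdorffMeasure hV, ← lintegral_indicator hCs]
  refine lintegral_congr fun u => ?_
  have hu : (u : V) ≠ 0 := ne_zero_of_mem_unit_sphere u
  have hTu : 0 < ‖T u‖ := norm_pos_iff.2 fun h => hu (hT (h.trans (map_zero T).symm))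
  by_cases huC : (u : V) ∈ C
  · rw [indicator_of_mem (by exact huC)]
    have : Prod.mk u ⁻¹' Y = Iio (⟨‖T u‖⁻¹, inv_pos.2 hTu⟩ : Ioi (0 : ℝ)) := by
      ext r
      have hr : (0 : ℝ) < r := r.2
      change ((r : ℝ) • (u : V) ∈ C ∧ ‖T ((r : ℝ) • (u : V))‖ < 1) ↔ (r : ℝ) < ‖T u‖⁻¹
      rw [and_iff_right (hcone _ hr _ huC), map_smul, norm_smul, Real.norm_of_nonneg hr.le,
        lt_inv_comm₀ hr hTu, ← one_div, lt_div_iff₀' hr]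
    rw [this, volumeIoiPow_apply_Iio]
    simp
  · rw [indicator_of_notMem (by exact huC)]
    have : Prod.mk u ⁻¹' Y = ∅ := by
      ext r
      have hr : (0 : ℝ) < r := r.2
      refine iff_of_false (fun h => huC ?_) (notMem_empty _)
      have := hcone _ (inv_pos.2 hr) _ h.1
      rwa [smul_smul, inv_mul_cancel₀ hr.ne', one_smul] at this
    rw [this, measure_empty]

/-! ### Faces, normal cones and the tiling of `P|E × E^⊥`. -/

variable {d k : ℕ}

/-- Every point in the interior of the projection of a convex body `P` to `E` lifts to a point of
`P` at which a functional with prescribed `E^⊥`-part is maximal. -/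
theorem exists_normal_of_mem_interior {P : Set (Euc d)} (hP : IsCompact P) (hconv : Convex ℝ P)
    (E : Submodule ℝ (Euc d)) (w : Euc d) {x : E}
    (hx : x ∈ interior (E.orthogonalProjectionOnto '' P)) :
    ∃ e : E, ∃ p ∈ P, E.orthogonalProjectionOnto p = x ∧
      ∀ y ∈ P, inner ℝ (w + e) y ≤ inner ℝ (w + e) p := by
  have hwc : Continuous fun y : Euc d => inner ℝ w y := by fun_prop
  obtain ⟨p₀, hp₀, hp₀x⟩ := interior_subset hx
  have hfib : IsCompact (P ∩ E.orthogonalProjectionOnto ⁻¹' {x}) :=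
    hP.inter_right (isClosed_singleton.preimage (by fun_prop))
  obtain ⟨p, ⟨hpP, hpx⟩, hpmax⟩ := hfib.exists_isMaxOn ⟨p₀, hp₀, hp₀x⟩ hwc.continuousOn
  obtain ⟨c, -, hc⟩ := hP.exists_isMinOn ⟨p₀, hp₀⟩ hwc.continuousOn
  -- `K` is the hypograph of the concave function sending a point of `P|E` to the maximum of `⟨w,
  -- ·⟩` on its fibre. A supporting functional `(g, l)` at the boundary point above `x` yields `e`,
  -- representing `g / l`.
  let K : Set (E × ℝ) := {z | ∃ y ∈ P, E.orthogonalProjectionOnto y = z.1 ∧ z.2 ≤ inner ℝ w y}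
  have hKconv : Convex ℝ K := by
    rintro z ⟨y, hy, hyz, hz⟩ z' ⟨y', hy', hyz', hz'⟩ a b ha hb hab
    refine ⟨a • y + b • y', hconv hy hy' ha hb hab, by simp [← hyz, ← hyz'], ?_⟩
    simp only [Prod.snd_add, Prod.smul_snd, smul_eq_mul, inner_add_right, inner_smul_right]
    gcongr
  have hKint : (interior K).Nonempty := by
    refine ⟨(x, inner ℝ w c - 1), mem_interior.2
      ⟨interior (E.orthogonalProjectionOnto '' P) ×ˢ Iio (inner ℝ w c), ?_,
        isOpen_interior.prod isOpen_Iio, hx, by simp⟩⟩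
    rintro ⟨y, t⟩ ⟨hy, ht⟩
    obtain ⟨q, hq, hqy⟩ := interior_subset hy
    exact ⟨q, hq, hqy, ht.le.trans (hc hq)⟩
  have hnot : (x, inner ℝ w p) ∉ interior K := by
    intro h
    have hopen : {t : ℝ | (x, t) ∈ interior K} ∈ nhds (inner ℝ w p : ℝ) :=
      (isOpen_interior.preimage (by fun_prop : Continuous fun t : ℝ => (x, t))).mem_nhds h
    obtain ⟨t, ht, hlt⟩ := (Filter.nonempty_of_mem (Filter.inter_mem
      (mem_nhdsWithin_of_mem_nhds hopen) self_mem_nhdsWithin) :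
      ({t : ℝ | (x, t) ∈ interior K} ∩ Ioi (inner ℝ w p : ℝ)).Nonempty)
    obtain ⟨y, hy, hyx, hty⟩ := interior_subset ht
    exact absurd (hty.trans (hpmax ⟨hy, hyx⟩)) (not_le.2 hlt)
  obtain ⟨f, hf0, hf⟩ := geometric_hahn_banach_of_nonempty_interior_point hKconv hnot hKint
  let g : StrongDual ℝ E := f.comp (ContinuousLinearMap.inl ℝ E ℝ)
  set l : ℝ := f (0, 1) with hl
  have hfg : ∀ (y : E) (t : ℝ), f (y, t) = g y + l * t := by
    intro y t
    have : (y, t) = (y, (0 : ℝ)) + t • ((0 : E), (1 : ℝ)) := by simp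
    rw [this, map_add, map_smul, smul_eq_mul, mul_comm]
    rfl
  have hmax : ∀ y ∈ P, g (E.orthogonalProjectionOnto y) + l * inner ℝ w y ≤
      g x + l * inner ℝ w p := by
    intro y hy
    have := hf (E.orthogonalProjectionOnto y, inner ℝ w y) ⟨y, hy, rfl, le_rfl⟩
    rwa [hfg, hfg] at this
  have hl0 : 0 ≤ l := by
    have := hf (x, inner ℝ w p - 1) ⟨p, hpP, hpx, by simp⟩
    rw [hfg, hfg] at this
    linarith
  -- The supporting hyperplane is not vertical: for `l = 0` the linear `g` would have a local
  -- maximum at the interior point `x`, hence vanish, and so would `f`.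
  have hlpos : 0 < l := by
    refine hl0.lt_of_ne' fun h0 => hf0 ?_
    have hloc : IsLocalMax g x := by
      filter_upwards [mem_interior_iff_mem_nhds.1 hx] with y hy
      obtain ⟨q, hq, rfl⟩ := hy
      have := hmax q hq
      simpa [h0] using this
    have hg : g = 0 := by
      have := hloc.fderiv_eq_zero
      rwa [g.fderiv] at this
    ext z
    · exact congrArg (fun h => h z) hg
    · simpa using h0
  let e : E := l⁻¹ • (InnerProductSpace.toDual ℝ E).symm g
  have he : ∀ y : Euc d, l * inner ℝ (e : Euc d) y = g (E.orthogonalProjectionOnto y) := by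
    intro y
    have : inner ℝ (e : Euc d) y = inner ℝ e (E.orthogonalProjectionOnto y) := by
      rw [Submodule.coe_inner]
      change _ = inner ℝ (e : Euc d) (E.starProjection y)
      rw [← Submodule.inner_starProjection_left_eq_right,
        Submodule.starProjection_eq_self_iff.2 e.2]
    rw [this]
    have h := real_inner_smul_left ((InnerProductSpace.toDual ℝ E).symm g)
      (E.orthogonalProjectionOnto y) l⁻¹
    rw [InnerProductSpace.toDual_symm_apply] at h
    refine (congrArg (l * ·) h).trans ?_
    simp [hlpos.ne']
  refine ⟨e, p, hpP, hpx, fun y hy => ?_⟩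
  have h1 := hmax y hy
  have hpx' : E.orthogonalProjectionOnto p = x := hpx
  rw [← he, ← hpx', ← he] at h1
  rw [inner_add_left, inner_add_left]
  refine le_of_mul_le_mul_left ?_ hlpos
  linarith

/-- The face of `P` in direction `u`. -/
def supportFace (P : Set (Euc d)) (u : Euc d) : Set (Euc d) :=
  {x ∈ P | ∀ y ∈ P, inner ℝ u y ≤ inner ℝ u x}

theorem isExposed_supportFace (P : Set (Euc d)) (u : Euc d) :
    IsExposed ℝ P (supportFace P u) :=
  fun _ => ⟨innerSL ℝ u, rfl⟩

theorem mem_normalCone_supportFace (P : Set (Euc d)) (u : Euc d) :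
    u ∈ normalCone P (supportFace P u) := fun x hx y hy => by
  rw [inner_sub_right]
  linarith [hx.2 y hy]

theorem subset_supportFace {P F : Set (Euc d)} (hF : F ⊆ P) {u : Euc d}
    (hu : u ∈ normalCone P F) : F ⊆ supportFace P u := fun x hx => ⟨hF hx, fun y hy => by
  have := hu x hx y hy
  rw [inner_sub_right] at this
  linarith⟩

/-- An exposed face contained in a set of at most the same dimension equals that set. -/
theorem eq_of_isExposed_of_finrank_le {P F G : Set (Euc d)} (hne : F.Nonempty)
    (hF : IsExposed ℝ P F) (hG : G ⊆ P) (hFG : F ⊆ G)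
    (hdim : Module.finrank ℝ (vectorSpan ℝ G) ≤ Module.finrank ℝ (vectorSpan ℝ F)) : F = G := by
  refine hFG.antisymm fun y hy => ?_
  have hspan := Submodule.eq_of_le_of_finrank_le (vectorSpan_mono ℝ hFG) hdim
  obtain ⟨x, hx⟩ := hne
  obtain ⟨l, hl⟩ := hF ⟨x, hx⟩
  have hker : vectorSpan ℝ F ≤ LinearMap.ker l.toLinearMap := by
    refine Submodule.span_le.2 ?_
    rintro _ ⟨a, ha, b, hb, rfl⟩
    rw [hl] at ha hb
    have h1 := ha.2 b hb.1
    have h2 := hb.2 a ha.1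
    simp only [SetLike.mem_coe, LinearMap.mem_ker, vsub_eq_sub, map_sub,
      ContinuousLinearMap.coe_coe]
    linarith
  have hyx : y - x ∈ vectorSpan ℝ F := hspan ▸ vsub_mem_vectorSpan ℝ hy (hFG hx)
  have hly : l y = l x := by
    have := hker hyx
    simpa [sub_eq_zero] using this
  have hx' := hx
  rw [hl] at hx' ⊢
  exact ⟨hG hy, fun z hz => hly ▸ hx'.2 z hz⟩

theorem IsPolytope.isCompact {P : Set (Euc d)} (hP : IsPolytope P) : IsCompact P := by
  obtain ⟨S, -, rfl⟩ := hP
  exact S.finite_toSet.isCompact_convexHull ℝ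

theorem IsPolytope.convex {P : Set (Euc d)} (hP : IsPolytope P) : Convex ℝ P := by
  obtain ⟨S, -, rfl⟩ := hP
  exact convex_convexHull ℝ _

/-- An exposed face is recovered from its extreme points, which are among the finitely many
generators of `P`. -/
theorem IsPolytope.finite_setOf_isExposed {P : Set (Euc d)} (hP : IsPolytope P) :
    {F | F.Nonempty ∧ IsExposed ℝ P F}.Finite := by
  have hc := hP.isCompact
  have hconv := hP.convex
  obtain ⟨S, -, rfl⟩ := hP
  refine Set.Finite.of_finite_image (f := fun F => extremePoints ℝ F)
    ((S.finite_toSet.finite_subsets).subset ?_) ?_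
  · rintro _ ⟨F, ⟨-, hF⟩, rfl⟩
    exact hF.isExtreme.extremePoints_subset_extremePoints.trans extremePoints_convexHull_subset
  · intro F hF G hG h
    rw [← closure_convexHull_extremePoints (hF.2.isCompact hc) (hF.2.convex hconv),
      ← closure_convexHull_extremePoints (hG.2.isCompact hc) (hG.2.convex hconv)]
    exact congrArg (fun A => closure (convexHull ℝ A)) h

theorem IsPolytope.finite_faces {P : Set (Euc d)} (hP : IsPolytope P) : (faces k P).Finite :=
  hP.finite_setOf_isExposed.subset fun _ h => ⟨h.1, h.2.1⟩

/-- The projection lies in an affine subspace of dimension at most `dim F`, hence proper in `E`. -/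
theorem volume_projection_eq_zero {F : Set (Euc d)} {E : Submodule ℝ (Euc d)}
    (h : Module.finrank ℝ (vectorSpan ℝ F) < Module.finrank ℝ E) :
    volume (E.orthogonalProjectionOnto '' F) = 0 := by
  rcases F.eq_empty_or_nonempty with rfl | ⟨x, hx⟩
  · simp
  let M : Submodule ℝ E := (vectorSpan ℝ F).map E.orthogonalProjectionOnto.toLinearMap
  refine measure_mono_null (t := (AffineSubspace.mk' (E.orthogonalProjectionOnto x) M : Set E)) ?_
    (addHaar_affineSubspace _ _ fun htop => ?_)
  · rintro _ ⟨y, hy, rfl⟩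
    rw [SetLike.mem_coe, AffineSubspace.mem_mk', vsub_eq_sub, ← map_sub]
    exact Submodule.mem_map_of_mem (vsub_mem_vectorSpan ℝ hy hx)
  · have : M = ⊤ := by
      rw [← AffineSubspace.direction_mk' (E.orthogonalProjectionOnto x) M, htop,
        AffineSubspace.direction_top]
    have h1 := Submodule.finrank_map_le E.orthogonalProjectionOnto.toLinearMap (vectorSpan ℝ F)
    change Module.finrank ℝ M ≤ _ at h1
    rw [this, finrank_top] at h1
    omega

/-- The normal cone lies in `F^⊥`, whose dimension `d - dim F` is less than `dim E^⊥`. -/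
theorem volume_projection_normalCone_eq_zero {P F : Set (Euc d)} (hne : F.Nonempty)
    (hF : IsExposed ℝ P F) {E : Submodule ℝ (Euc d)}
    (h : Module.finrank ℝ E < Module.finrank ℝ (vectorSpan ℝ F)) :
    volume (Eᗮ.orthogonalProjectionOnto '' normalCone P F) = 0 := by
  let M : Submodule ℝ Eᗮ := ((vectorSpan ℝ F)ᗮ).map Eᗮ.orthogonalProjectionOnto.toLinearMap
  refine measure_mono_null (t := (M : Set Eᗮ)) ?_ (addHaar_submodule _ _ fun htop => ?_)
  · rintro _ ⟨u, hu, rfl⟩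
    exact Submodule.mem_map_of_mem (mem_perp (k := Module.finrank ℝ (vectorSpan ℝ F))
      ⟨hne, hF, rfl⟩ hu)
  · have h1 := Submodule.finrank_map_le Eᗮ.orthogonalProjectionOnto.toLinearMap (vectorSpan ℝ F)ᗮ
    change Module.finrank ℝ M ≤ _ at h1
    rw [htop, finrank_top] at h1
    have h2 := E.finrank_add_finrank_orthogonal
    have h3 := (vectorSpan ℝ F).finrank_add_finrank_orthogonal
    omega

theorem isClosed_normalCone (P F : Set (Euc d)) : IsClosed (normalCone P F) := by
  simp only [normalCone, ofPred_forall]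
  exact isClosed_iInter fun x => isClosed_iInter fun _ => isClosed_iInter fun y =>
    isClosed_iInter fun _ => isClosed_le (by fun_prop) continuous_const

/-- A linear image of a closed cone need not be closed, but it is σ-compact. -/
theorem measurableSet_projection_normalCone (P F : Set (Euc d)) (E : Submodule ℝ (Euc d)) :
    MeasurableSet (E.orthogonalProjectionOnto '' normalCone P F) := by
  obtain ⟨K, hK, hKU⟩ := ((isSigmaCompact_univ).of_isClosed_subset
    (isClosed_normalCone P F) (subset_univ _)).image E.orthogonalProjectionOnto.continuous
  rw [← hKU]
  exact MeasurableSet.iUnion fun n => (hK n).isClosed.measurableSet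

/-- Two normal vectors with the same `E^⊥`-part at points with the same projection to `E` are
both normal at both points. -/
theorem inner_eq_of_projection_eq {P : Set (Euc d)} {E : Submodule ℝ (Euc d)} {p q u v : Euc d}
    (hpq : E.orthogonalProjectionOnto p = E.orthogonalProjectionOnto q)
    (huv : Eᗮ.orthogonalProjectionOnto u = Eᗮ.orthogonalProjectionOnto v)
    (hp : p ∈ supportFace P u) (hq : q ∈ supportFace P v) :
    inner ℝ u p = inner ℝ u q ∧ inner ℝ v p = inner ℝ v q := by
  have h1 : p - q ∈ Eᗮ := by
    rw [← Submodule.orthogonalProjectionOnto_eq_zero_iff, map_sub, hpq, sub_self]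
  have h2 : u - v ∈ E := by
    rw [← Submodule.orthogonal_orthogonal E, ← Submodule.orthogonalProjectionOnto_eq_zero_iff,
      map_sub, huv, sub_self]
  -- The number `⟨u - v, p - q⟩` is the sum of `⟨u, p - q⟩` and `⟨v, q - p⟩`, both nonnegative by
  -- maximality. As it is zero, both vanish.
  have h3 : inner ℝ (u - v) (p - q) = (0 : ℝ) := h1 _ h2
  have h4 := hp.2 q hq.1
  have h5 := hq.2 p hp.1
  simp only [inner_sub_left, inner_sub_right] at h3
  constructor <;> linarith

/-- For generic `(x, w) ∈ E × E^⊥` with `x` in the interior of `P|E` there is a `k`-face `F` of `P`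
with `x ∈ F|E` and `w ∈ N(P,F)|E^⊥`. -/
theorem exists_face_of_mem_interior {P : Set (Euc d)} (hP : IsPolytope P)
    {E : Submodule ℝ (Euc d)} {x : E} {w : Eᗮ}
    (hx : ∀ F : Set (Euc d), F.Nonempty → IsExposed ℝ P F →
      Module.finrank ℝ (vectorSpan ℝ F) < k → x ∉ E.orthogonalProjectionOnto '' F)
    (hw : ∀ F : Set (Euc d), F.Nonempty → IsExposed ℝ P F →
      k < Module.finrank ℝ (vectorSpan ℝ F) → w ∉ Eᗮ.orthogonalProjectionOnto '' normalCone P F)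
    (hxP : x ∈ interior (E.orthogonalProjectionOnto '' P)) :
    ∃ F ∈ faces k P, x ∈ E.orthogonalProjectionOnto '' F ∧
      w ∈ Eᗮ.orthogonalProjectionOnto '' normalCone P F := by
  obtain ⟨e, p, hpP, hpx, hmax⟩ := exists_normal_of_mem_interior hP.isCompact hP.convex E w hxP
  have hp : p ∈ supportFace P (w + e) := ⟨hpP, hmax⟩
  have hw' : w ∈ Eᗮ.orthogonalProjectionOnto '' normalCone P (supportFace P (w + e)) :=
    ⟨_, mem_normalCone_supportFace P _, by
      rw [map_add, Submodule.orthogonalProjectionOnto_mem_subspace_eq_self,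
        Submodule.orthogonalProjectionOnto_orthogonal_apply_eq_zero e.2, add_zero]⟩
  have hx' : x ∈ E.orthogonalProjectionOnto '' supportFace P (w + e) := ⟨p, hp, hpx⟩
  refine ⟨_, ⟨⟨p, hp⟩, isExposed_supportFace P _, ?_⟩, hx', hw'⟩
  refine le_antisymm ?_ ?_
  · by_contra! h
    exact hw _ ⟨p, hp⟩ (isExposed_supportFace P _) h hw'
  · by_contra! h
    exact hx _ ⟨p, hp⟩ (isExposed_supportFace P _) h hx'

/-- Uniqueness of the face in `exists_face_of_mem_interior`. -/
theorem face_unique {P : Set (Euc d)} {E : Submodule ℝ (Euc d)} {x : E} {w : Eᗮ}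
    (hx : ∀ F : Set (Euc d), F.Nonempty → IsExposed ℝ P F →
      Module.finrank ℝ (vectorSpan ℝ F) < k → x ∉ E.orthogonalProjectionOnto '' F)
    (hw : ∀ F : Set (Euc d), F.Nonempty → IsExposed ℝ P F →
      k < Module.finrank ℝ (vectorSpan ℝ F) → w ∉ Eᗮ.orthogonalProjectionOnto '' normalCone P F)
    {F G : Set (Euc d)} (hF : F ∈ faces k P) (hG : G ∈ faces k P)
    (hxF : x ∈ E.orthogonalProjectionOnto '' F) (hxG : x ∈ E.orthogonalProjectionOnto '' G)
    (hwF : w ∈ Eᗮ.orthogonalProjectionOnto '' normalCone P F)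
    (hwG : w ∈ Eᗮ.orthogonalProjectionOnto '' normalCone P G) : F = G := by
  -- Since `w` avoids the projected normal cones of faces of dimension above `k`, a normal vector of
  -- `F` over `w` supports nothing larger than `F`.
  have hsupp : ∀ {F : Set (Euc d)} {u : Euc d}, F ∈ faces k P → u ∈ normalCone P F →
      Eᗮ.orthogonalProjectionOnto u = w → F = supportFace P u := by
    intro F u hF hu huw
    have hsub := subset_supportFace hF.2.1.subset hu
    refine eq_of_isExposed_of_finrank_le hF.1 hF.2.1 (fun _ h => h.1) hsub ?_
    rw [hF.2.2]
    by_contra! h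
    exact hw _ (hF.1.mono hsub) (isExposed_supportFace P _) h
      ⟨u, mem_normalCone_supportFace P u, huw⟩
  obtain ⟨p, hpF, hpx⟩ := hxF
  obtain ⟨q, hqG, hqx⟩ := hxG
  obtain ⟨u, hu, huw⟩ := hwF
  obtain ⟨v, hv, hvw⟩ := hwG
  have hFu := hsupp hF hu huw
  have hGv := hsupp hG hv hvw
  have hp : p ∈ supportFace P u := hFu ▸ hpF
  have hq : q ∈ supportFace P v := hGv ▸ hqG
  obtain ⟨h1, h2⟩ := inner_eq_of_projection_eq (hpx.trans hqx.symm) (huw.trans hvw.symm) hp hq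
  -- `p` maximizes both `u` and `v`, so the face in direction `u + v` is contained in `F ∩ G`. It
  -- has a point above `x`, so its dimension is at least `k`, and it equals both faces.
  have hpuv : p ∈ supportFace P (u + v) := ⟨hp.1, fun y hy => by
    rw [inner_add_left, inner_add_left]
    have := hp.2 y hy
    have := hq.2 y hy
    linarith⟩
  have hsub : supportFace P (u + v) ⊆ supportFace P u ∩ supportFace P v := by
    intro z hz
    have hz' := hz.2 p hp.1
    rw [inner_add_left, inner_add_left] at hz'
    have h3 := hp.2 z hz.1
    have h4 := hq.2 z hz.1
    refine ⟨⟨hz.1, fun y hy => ?_⟩, ⟨hz.1, fun y hy => ?_⟩⟩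
    · have := hp.2 y hy
      linarith
    · have := hq.2 y hy
      linarith
  have hdim : k ≤ Module.finrank ℝ (vectorSpan ℝ (supportFace P (u + v))) := by
    by_contra! h
    exact hx _ ⟨p, hpuv⟩ (isExposed_supportFace P _) h ⟨p, hpuv, hpx⟩
  have e1 : supportFace P (u + v) = F :=
    eq_of_isExposed_of_finrank_le ⟨p, hpuv⟩ (isExposed_supportFace P _) hF.2.1.subset
      (hFu ▸ hsub.trans inter_subset_left) (hF.2.2.trans_le hdim)
  have e2 : supportFace P (u + v) = G :=
    eq_of_isExposed_of_finrank_le ⟨p, hpuv⟩ (isExposed_supportFace P _) hG.2.1.subset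
      (hGv ▸ hsub.trans inter_subset_right) (hG.2.2.trans_le hdim)
  exact e1.symm.trans e2

/-- The products of the projections to `E` of the `k`-faces of `P` with the projections to `E^⊥` of
their normal cones tile `P|E × E^⊥`. -/
theorem volume_projection_mul_volume_ball {P : Set (Euc d)} (hP : IsPolytope P)
    {E : Submodule ℝ (Euc d)} (hE : Module.finrank ℝ E = k) :
    volume (E.orthogonalProjectionOnto '' P) * volume (ball (0 : Eᗮ) 1) =
      ∑' F : faces k P, volume (E.orthogonalProjectionOnto '' F.1) *
        volume (Eᗮ.orthogonalProjectionOnto '' normalCone P F.1 ∩ ball 0 1) := by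
  have hfin := hP.finite_setOf_isExposed
  have : Finite (faces k P) := hP.finite_faces
  have hae1 : ∀ᵐ x : E, (∀ F : Set (Euc d), F.Nonempty → IsExposed ℝ P F →
      Module.finrank ℝ (vectorSpan ℝ F) < k → x ∉ E.orthogonalProjectionOnto '' F) := by
    have : ∀ᵐ x : E, ∀ F ∈ {F | F.Nonempty ∧ IsExposed ℝ P F},
        Module.finrank ℝ (vectorSpan ℝ F) < k → x ∉ E.orthogonalProjectionOnto '' F :=
      (ae_ball_iff hfin.countable).2 fun F hF => by
        rw [ae_all_iff]
        intro h
        exact measure_eq_zero_iff_ae_notMem.1 (volume_projection_eq_zero (hE ▸ h))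
    filter_upwards [this] with x hx F h1 h2 using hx F ⟨h1, h2⟩
  have hae2 : ∀ᵐ w : Eᗮ, (∀ F : Set (Euc d), F.Nonempty → IsExposed ℝ P F →
      k < Module.finrank ℝ (vectorSpan ℝ F) →
        w ∉ Eᗮ.orthogonalProjectionOnto '' normalCone P F) := by
    have : ∀ᵐ w : Eᗮ, ∀ F ∈ {F | F.Nonempty ∧ IsExposed ℝ P F},
        k < Module.finrank ℝ (vectorSpan ℝ F) →
          w ∉ Eᗮ.orthogonalProjectionOnto '' normalCone P F :=
      (ae_ball_iff hfin.countable).2 fun F hF => by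
        rw [ae_all_iff]
        intro h
        exact measure_eq_zero_iff_ae_notMem.1
          (volume_projection_normalCone_eq_zero hF.1 hF.2 (hE.symm ▸ h))
    filter_upwards [this] with x hx F h1 h2 using hx F ⟨h1, h2⟩
  have hconv : Convex ℝ (E.orthogonalProjectionOnto '' P) :=
    hP.convex.linear_image E.orthogonalProjectionOnto.toLinearMap
  -- The existence of a face needs `x` in the interior; the boundary of a convex set is null. This
  -- also covers a projection with empty interior.
  have hae3 : ∀ᵐ x : E, x ∉ frontier (E.orthogonalProjectionOnto '' P) :=
    measure_eq_zero_iff_ae_notMem.1 (hconv.addHaar_frontier volume)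
  have hprod1 := (quasiMeasurePreserving_fst (μ := (volume : Measure E))
    (ν := (volume : Measure Eᗮ))).ae (hae1.and hae3)
  have hprod2 := (quasiMeasurePreserving_snd (μ := (volume : Measure E))
    (ν := (volume : Measure Eᗮ))).ae hae2
  have hmeas : ∀ F : faces k P, MeasurableSet ((E.orthogonalProjectionOnto '' F.1) ×ˢ
      (Eᗮ.orthogonalProjectionOnto '' normalCone P F.1 ∩ ball 0 1)) := fun F =>
    (((F.2.2.1.isCompact hP.isCompact).image
      E.orthogonalProjectionOnto.continuous).isClosed.measurableSet).prod
      ((measurableSet_projection_normalCone _ _ _).inter measurableSet_ball)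
  simp_rw [← prod_prod]
  rw [← measure_iUnion₀ _ fun F => (hmeas F).nullMeasurableSet]
  · refine measure_congr ?_
    filter_upwards [hprod1, hprod2] with z ⟨hz1, hz3⟩ hz2
    refine propext ⟨fun hz => ?_, fun hz => ?_⟩
    · have hint : z.1 ∈ interior (E.orthogonalProjectionOnto '' P) := by
        by_contra h
        exact hz3 ⟨subset_closure hz.1, h⟩
      obtain ⟨F, hF, h1, h2⟩ := exists_face_of_mem_interior hP hz1 hz2 hint
      exact mem_iUnion.2 ⟨⟨F, hF⟩, h1, h2, hz.2⟩
    · obtain ⟨F, h1, h2⟩ := mem_iUnion.1 hz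
      exact ⟨image_mono F.2.2.1.subset h1, h2.2⟩
  · intro F G hFG
    rw [Function.onFun, AEDisjoint, measure_eq_zero_iff_ae_notMem]
    filter_upwards [hprod1, hprod2] with z ⟨hz1, _⟩ hz2 hz
    exact hFG (Subtype.ext (face_unique hz1 hz2 F.2 G.2 hz.1.1 hz.2.1 hz.1.2.1 hz.2.2.1))

/-! ### The contribution of a single face. -/

theorem volume_projection_eq {F : Set (Euc d)} {E : Submodule ℝ (Euc d)} (hne : F.Nonempty)
    (hF : Module.finrank ℝ (vectorSpan ℝ F) = k) (hE : Module.finrank ℝ E = k) :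
    volume (E.orthogonalProjectionOnto '' F) =
      ENNReal.ofReal (projOnto (vectorSpan ℝ F) E).normDet * μHE[k] F := by
  obtain ⟨x, hx⟩ := hne
  -- Translating `F` into its direction space makes the projection a linear map between spaces of
  -- equal dimension, which scales volume by its determinant.
  let S : Set (vectorSpan ℝ F) := {s | x + s ∈ F}
  have hFS : F = (fun s : vectorSpan ℝ F => x + s) '' S := by
    ext y
    constructor
    · intro hy
      exact ⟨⟨y - x, vsub_mem_vectorSpan ℝ hy hx⟩, by simpa [S] using hy, by simp⟩
    · rintro ⟨s, hs, rfl⟩; exact hs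
  have hiso : Isometry fun s : vectorSpan ℝ F => x + (s : Euc d) :=
    (isometry_add_left x).comp isometry_subtype_coe
  have himg : E.orthogonalProjectionOnto '' F =
      (fun y => E.orthogonalProjectionOnto x + y) '' (projOnto (vectorSpan ℝ F) E '' S) := by
    conv_lhs => rw [hFS]
    rw [image_image, image_image]
    exact image_congr fun s _ => map_add _ _ _
  have h1 : (volume : Measure E) = μHE[k] := by
    rw [← hE, InnerProductSpace.euclideanHausdorffMeasure_eq_volume]
  have h2 : μHE[k] F = μHE[k] S := by
    conv_lhs => rw [hFS]
    exact hiso.euclideanHausdorffMeasure_image S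
  have h3 := (projOnto (vectorSpan ℝ F) E).euclideanHausdorffMeasure_image S
  rw [hF] at h3
  rw [himg, h1, (isometry_add_left _).euclideanHausdorffMeasure_image, h3, h2]

theorem measurableSet_sphericalNormals (P F : Set (Euc d)) :
    MeasurableSet (sphericalNormals P F) :=
  ((isClosed_normalCone P F).inter isClosed_sphere).measurableSet

/-- Polar coordinates take place on the unit sphere of `F^⊥`, the flag measure in `ℝ^d`; the
inclusion is isometric and so preserves Hausdorff measure. -/
theorem lintegral_sphere_eq_lintegral_sphericalNormals {P F : Set (Euc d)}
    (hF : F ∈ faces k P) (n : ℕ) {g : Euc d → ℝ≥0∞} (hg : Measurable g) :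
    ∫⁻ u in {u : sphere (0 : (vectorSpan ℝ F)ᗮ) 1 | (u : Euc d) ∈ normalCone P F}, g u ∂μHE[n] =
      ∫⁻ u : sphericalNormals P F, g u
        ∂(Measure.comap (Subtype.val : sphericalNormals P F → Euc d) μHE[n]) := by
  have hiso : Isometry fun u : sphere (0 : (vectorSpan ℝ F)ᗮ) 1 => (u : Euc d) :=
    isometry_subtype_coe.comp isometry_subtype_coe
  have hpre : {u : sphere (0 : (vectorSpan ℝ F)ᗮ) 1 | (u : Euc d) ∈ normalCone P F} =
      (fun u : sphere (0 : (vectorSpan ℝ F)ᗮ) 1 => (u : Euc d)) ⁻¹' sphericalNormals P F := by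
    ext u
    have : ‖(u : (vectorSpan ℝ F)ᗮ)‖ = 1 := by simp
    refine ⟨fun h => ⟨h, ?_⟩, fun h => h.1⟩
    rw [mem_sphere_zero_iff_norm]
    exact this
  have hrange : sphericalNormals P F ⊆
      range fun u : sphere (0 : (vectorSpan ℝ F)ᗮ) 1 => (u : Euc d) := by
    intro u hu
    refine ⟨⟨⟨u, mem_perp hF hu.1⟩, ?_⟩, rfl⟩
    rw [mem_sphere_zero_iff_norm]
    exact mem_sphere_zero_iff_norm.1 hu.2
  have hm := measurableSet_sphericalNormals P F
  rw [lintegral_subtype_comap hm, hpre,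
    ← setLIntegral_map hm hg hiso.continuous.measurable, hiso.map_euclideanHausdorffMeasure,
    restrict_restrict hm, inter_eq_self_of_subset_left hrange]

/-- The part of the projected normal cone in the unit ball, as an integral over the spherical
image of the face. -/
theorem volume_projection_normalCone_inter_ball {P F : Set (Euc d)} {E : Submodule ℝ (Euc d)}
    (hkd : k + 1 ≤ d) (hF : F ∈ faces k P) (hE : Module.finrank ℝ E = k)
    (hD : (projOnto (vectorSpan ℝ F)ᗮ Eᗮ).normDet ≠ 0) :
    volume (Eᗮ.orthogonalProjectionOnto '' normalCone P F ∩ ball 0 1) =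
      ENNReal.ofReal (projOnto (vectorSpan ℝ F)ᗮ Eᗮ).normDet *
        ∫⁻ u : sphericalNormals P F,
          ENNReal.ofReal (‖Eᗮ.starProjection u‖⁻¹ ^ (d - k) / ((d - k : ℕ) : ℝ))
          ∂(Measure.comap (Subtype.val : sphericalNormals P F → Euc d) μHE[d - 1 - k]) := by
  obtain ⟨n, hn⟩ : ∃ n, d - k = n + 1 := ⟨d - 1 - k, by omega⟩
  have hn' : d - 1 - k = n := by omega
  have hL : Module.finrank ℝ (vectorSpan ℝ F)ᗮ = n + 1 := by
    have := (vectorSpan ℝ F).finrank_add_finrank_orthogonal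
    rw [finrank_euclideanSpace_fin, hF.2.2] at this
    omega
  have hE' : Module.finrank ℝ Eᗮ = n + 1 := by
    have := E.finrank_add_finrank_orthogonal
    rw [finrank_euclideanSpace_fin, hE] at this
    omega
  let T : (vectorSpan ℝ F)ᗮ →L[ℝ] Eᗮ :=
    Eᗮ.orthogonalProjectionOnto.comp (vectorSpan ℝ F)ᗮ.subtypeL
  have hTinj : Function.Injective T := by
    have := ((projOnto (vectorSpan ℝ F)ᗮ Eᗮ).normDet_ne_zero_tfae.out 0 4).1 hD
    exact this
  let C : Set (vectorSpan ℝ F)ᗮ := {v | (v : Euc d) ∈ normalCone P F}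
  have hC : MeasurableSet C :=
    ((isClosed_normalCone P F).preimage continuous_subtype_val).measurableSet
  have hcone : ∀ r : ℝ, 0 < r → ∀ x ∈ C, r • x ∈ C := by
    intro r hr x hx a ha b hb
    rw [Submodule.coe_smul, inner_smul_left]
    exact mul_nonpos_of_nonneg_of_nonpos hr.le (hx a ha b hb)
  have hset : Eᗮ.orthogonalProjectionOnto '' normalCone P F ∩ ball 0 1 =
      projOnto (vectorSpan ℝ F)ᗮ Eᗮ '' (C ∩ {x | ‖T x‖ < 1}) := by
    ext y
    constructor
    · rintro ⟨⟨u, hu, rfl⟩, hy⟩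
      exact ⟨⟨u, mem_perp hF hu⟩, ⟨hu, mem_ball_zero_iff.1 hy⟩, rfl⟩
    · rintro ⟨u, ⟨hu, hu'⟩, rfl⟩
      exact ⟨⟨u, hu, rfl⟩, mem_ball_zero_iff.2 hu'⟩
  have hvol : (volume : Measure Eᗮ) = μHE[Module.finrank ℝ (vectorSpan ℝ F)ᗮ] := by
    rw [hL, ← hE', InnerProductSpace.euclideanHausdorffMeasure_eq_volume]
  rw [hset, hvol, LinearMap.euclideanHausdorffMeasure_image_eq_normDet_mul_volume,
    volume_cone_inter_norm_lt_one hL hC hcone T hTinj, hn, hn']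
  congr 1
  rw [← lintegral_sphere_eq_lintegral_sphericalNormals hF n
    (g := fun u => ENNReal.ofReal (‖Eᗮ.starProjection u‖⁻¹ ^ (n + 1) / ((n + 1 : ℕ) : ℝ)))
    (by fun_prop)]
  simp only [Nat.cast_add, Nat.cast_one]
  rfl

/-! ### The integrand and the flag measure. -/

/-- On flags `(u, U)` the integrand is `⟨U, E^⊥⟩² / ‖u|E^⊥‖^(d-k)`. -/
theorem integrand_eq (hkd : k + 2 ≤ d) (E : Grass d k) (x : FlagManifold d (d - k)) :
    integrand E x =
      (projOnto x.space E.1ᗮ).normDet ^ 2 / ‖E.1ᗮ.starProjection x.vec‖ ^ (d - k) := by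
  have hmem : E.1ᗮ.starProjection x.vec = 0 ↔ x.vec ∈ E.1 := by
    rw [Submodule.starProjection_apply, Submodule.coe_eq_zero,
      Submodule.orthogonalProjectionOnto_eq_zero_iff, Submodule.orthogonal_orthogonal]
  rw [integrand]
  split_ifs with h
  · rw [hmem.2 h, norm_zero, zero_pow (by omega), div_zero]
  · have hn : ‖E.1ᗮ.starProjection x.vec‖ ≠ 0 := fun h0 => h (hmem.1 (norm_eq_zero.1 h0))
    have hE := E.1.finrank_add_finrank_orthogonal
    rw [finrank_euclideanSpace_fin, E.2] at hE
    have hx : Module.finrank ℝ x.space = d - k := x.1.2.2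
    rw [normDet_projOnto_vecPerp (A := x.space) (u := x.vec) (by omega) x.2 (by
      exact mem_sphere_zero_iff_norm.1 x.1.1.2) (norm_ne_zero_iff.1 hn)]
    -- The square of the split-off factor raises the exponent from `d-k-2` to `d-k`.
    rw [div_pow, div_div, ← pow_add, Nat.add_sub_cancel' (by omega)]

theorem continuous_vec (d q : ℕ) : Continuous (FlagManifold.vec : FlagManifold d q → Euc d) :=
  continuous_subtype_val.comp (continuous_fst.comp continuous_subtype_val)

theorem measurableSet_space_eq {q : ℕ} (U : Submodule ℝ (Euc d)) :
    MeasurableSet {x : FlagManifold d q | x.space = U} := by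
  have hc : Continuous fun x : FlagManifold d q => x.space.starProjection :=
    (continuous_induced_dom (f := fun U : Grass d q => U.1.starProjection)).comp
      (continuous_snd.comp continuous_subtype_val)
  have : {x : FlagManifold d q | x.space = U} =
      (fun x : FlagManifold d q => x.space.starProjection) ⁻¹' {U.starProjection} := by
    ext x
    exact Submodule.starProjection_inj.symm
  rw [this]
  exact (isClosed_singleton.preimage hc).measurableSet

/-- The image of the Hausdorff measure on `n(P,F)` under `u ↦ (u, F^⊥)`. -/
noncomputable def faceMeasure (P : Set (Euc d)) (F : faces k P) : Measure (FlagManifold d (d - k)) :=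
  (Measure.comap (Subtype.val : sphericalNormals P F.1 → Euc d) μHE[d - 1 - k]).map (flagMap P F)

/-- The measure of a face is carried by flags with `U = F^⊥`. There the determinant is constant and
a measurable function of `u` alone remains, so measurability of the determinant in `U` is not
needed. -/
theorem integrand_ae_eq (hkd : k + 2 ≤ d) (E : Grass d k) (P : Set (Euc d)) (F : faces k P) :
    integrand E =ᵐ[faceMeasure P F] fun x =>
      (projOnto (vectorSpan ℝ F.1)ᗮ E.1ᗮ).normDet ^ 2 /
        ‖E.1ᗮ.starProjection x.vec‖ ^ (d - k) := by
  have h : ∀ᵐ x ∂(faceMeasure P F), x.space = (vectorSpan ℝ F.1)ᗮ :=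
    (ae_map_iff (measurable_flagMap P F).aemeasurable (measurableSet_space_eq _)).2
      (Filter.Eventually.of_forall fun u => rfl)
  filter_upwards [h] with x hx
  rw [integrand_eq hkd, hx]

theorem measurable_flagDensity (E : Grass d k) (c : ℝ) :
    Measurable fun x : FlagManifold d (d - k) =>
      c / ‖E.1ᗮ.starProjection x.vec‖ ^ (d - k) := by
  have : Measurable (FlagManifold.vec : FlagManifold d (d - k) → Euc d) :=
    (continuous_vec d _).measurable
  fun_prop

theorem flagMeasure_eq (P : Set (Euc d)) :
    flagMeasure k P = Measure.sum fun F : faces k P => μHE[k] F.1 • faceMeasure P F := rfl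

theorem aestronglyMeasurable_integrand (hkd : k + 2 ≤ d) (E : Grass d k) {P : Set (Euc d)}
    (hP : IsPolytope P) : AEStronglyMeasurable (integrand E) (flagMeasure k P) := by
  have : Finite (faces k P) := hP.finite_faces
  rw [flagMeasure_eq, aestronglyMeasurable_sum_measure_iff]
  exact fun F => AEStronglyMeasurable.smul_measure
    ⟨_, (measurable_flagDensity E _).stronglyMeasurable, integrand_ae_eq hkd E P F⟩ _

theorem lintegral_integrand_faceMeasure (hkd : k + 2 ≤ d) (E : Grass d k) (P : Set (Euc d))
    (F : faces k P) :
    ∫⁻ x, ENNReal.ofReal (integrand E x) ∂(faceMeasure P F) =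
      ∫⁻ u : sphericalNormals P F.1,
        ENNReal.ofReal ((projOnto (vectorSpan ℝ F.1)ᗮ E.1ᗮ).normDet ^ 2 /
          ‖E.1ᗮ.starProjection u‖ ^ (d - k))
        ∂(Measure.comap (Subtype.val : sphericalNormals P F.1 → Euc d) μHE[d - 1 - k]) := by
  refine (lintegral_congr_ae ((integrand_ae_eq hkd E P F).fun_comp ENNReal.ofReal)).trans ?_
  refine (lintegral_map (measurable_flagDensity E _).ennreal_ofReal (measurable_flagMap P F)).trans ?_
  rfl

theorem mul_volume_eq_lintegral_face (hkd : k + 2 ≤ d) (E : Grass d k) (P : Set (Euc d))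
    (F : faces k P) :
    ((d - k : ℕ) : ℝ≥0∞) * (volume (E.1.orthogonalProjectionOnto '' F.1) *
        volume (E.1ᗮ.orthogonalProjectionOnto '' normalCone P F.1 ∩ ball 0 1)) =
      μHE[k] F.1 * ∫⁻ x, ENNReal.ofReal (integrand E x) ∂(faceMeasure P F) := by
  have hLE : Module.finrank ℝ (vectorSpan ℝ F.1) = Module.finrank ℝ E.1 := F.2.2.2.trans E.2.symm
  rw [lintegral_integrand_faceMeasure hkd, volume_projection_eq F.2.1 F.2.2.2 E.2,
    ← normDet_projOnto_orthogonal hLE]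
  -- If `D = 0`, the projection `F^⊥ → E^⊥` is not injective and polar coordinates are unavailable,
  -- but both sides vanish.
  by_cases hD : (projOnto (vectorSpan ℝ F.1)ᗮ E.1ᗮ).normDet = 0
  · simp [hD]
  rw [volume_projection_normalCone_inter_ball (by omega) F.2 E.2 hD]
  set D := (projOnto (vectorSpan ℝ F.1)ᗮ E.1ᗮ).normDet with hDdef
  have hD0 : 0 ≤ D := LinearMap.normDet_nonneg _
  have hm : ((d - k : ℕ) : ℝ) ≠ 0 := by
    rw [Nat.cast_ne_zero]; omega
  -- One factor `D` belongs to the projected face and one to the projected normal cone; the factor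
  -- `d-k` cancels the denominator from radial integration.
  have hint : ∀ u : Euc d, ENNReal.ofReal (D ^ 2 / ‖E.1ᗮ.starProjection u‖ ^ (d - k)) =
      (((d - k : ℕ) : ℝ≥0∞) * ENNReal.ofReal D ^ 2) *
        ENNReal.ofReal (‖E.1ᗮ.starProjection u‖⁻¹ ^ (d - k) / ((d - k : ℕ) : ℝ)) := by
    intro u
    rw [← ENNReal.ofReal_natCast, ← ENNReal.ofReal_pow hD0, ← ENNReal.ofReal_mul (by positivity),
      ← ENNReal.ofReal_mul (by positivity)]
    congr 1
    rw [inv_pow]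
    field_simp
  simp_rw [hint]
  rw [lintegral_const_mul' _ _ (by finiteness)]
  ring

/-! ### Normalization and summation over the faces. -/

theorem omega_finrank {W : Type*} [NormedAddCommGroup W] [InnerProductSpace ℝ W]
    [FiniteDimensional ℝ W] [MeasurableSpace W] [BorelSpace W] {m : ℕ} (hm : 0 < m)
    (hW : Module.finrank ℝ W = m) :
    ENNReal.ofReal (omega m) = m * volume (ball (0 : W) 1) := by
  have : NeZero m := ⟨hm.ne'⟩
  have h : volume (closedBall (0 : Euc m) 1) = volume (ball (0 : W) 1) := by
    have hmp := ((stdOrthonormalBasis ℝ W).reindex (finCongr hW)).measurePreserving_repr_symm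
    rw [← hmp.measure_preimage measurableSet_ball.nullMeasurableSet,
      LinearIsometryEquiv.preimage_ball, map_zero, addHaar_closedBall_eq_addHaar_ball]
  rw [omega, ENNReal.ofReal_mul (by positivity), ENNReal.ofReal_natCast,
    ENNReal.ofReal_toReal measure_closedBall_lt_top.ne, h]

theorem omega_pos {m : ℕ} (hm : 0 < m) : 0 < omega m := by
  have h : 0 < (volume (closedBall (0 : Euc m) 1)).toReal :=
    ENNReal.toReal_pos (measure_closedBall_pos _ _ one_pos).ne' measure_closedBall_lt_top.ne
  have : (0 : ℝ) < m := by exact_mod_cast hm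
  exact mul_pos this h

theorem euclideanHausdorffMeasure_projection (P : Set (Euc d)) (E : Grass d k) :
    μHE[k] (E.1.starProjection '' P) = volume (E.1.orthogonalProjectionOnto '' P) := by
  have : E.1.starProjection '' P = Subtype.val '' (E.1.orthogonalProjectionOnto '' P) := by
    rw [image_image]; rfl
  rw [this, isometry_subtype_coe.euclideanHausdorffMeasure_image,
    ← InnerProductSpace.euclideanHausdorffMeasure_eq_volume, E.2]

/-- The projection formula in terms of Lebesgue integrals. -/
theorem lintegral_integrand_flagMeasure (hkd : k + 2 ≤ d) {P : Set (Euc d)} (hP : IsPolytope P)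
    (E : Grass d k) :
    ∫⁻ x, ENNReal.ofReal (integrand E x) ∂(flagMeasure k P) =
      ENNReal.ofReal (omega (d - k)) * μHE[k] (E.1.starProjection '' P) := by
  have hE : Module.finrank ℝ E.1ᗮ = d - k := by
    have := E.1.finrank_add_finrank_orthogonal
    rw [finrank_euclideanSpace_fin, E.2] at this
    omega
  rw [omega_finrank (by omega) hE, euclideanHausdorffMeasure_projection, mul_assoc,
    mul_comm (volume (ball _ _)), volume_projection_mul_volume_ball hP E.2, ← ENNReal.tsum_mul_left,
    flagMeasure_eq, lintegral_sum_measure]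
  refine tsum_congr fun F => ?_
  rw [lintegral_smul_measure, mul_volume_eq_lintegral_face hkd, smul_eq_mul]

theorem integrand_nonneg (E : Grass d k) (x : FlagManifold d (d - k)) : 0 ≤ integrand E x := by
  rw [integrand]
  split_ifs
  · exact le_rfl
  · positivity

end FlagProj

theorem theorem1 (d k : ℕ) (hk : 1 ≤ k) (hkd : k + 2 ≤ d)
    (P : Set (FlagProj.Euc d)) (hP : FlagProj.IsPolytope P) (E : FlagProj.Grass d k) :
    Integrable (FlagProj.integrand E) (FlagProj.flagMeasure k P) ∧
      FlagProj.projectionFunction k P E =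
        (FlagProj.omega (d - k))⁻¹ * ∫ x, FlagProj.integrand E x ∂(FlagProj.flagMeasure k P) := by
  have hω := FlagProj.omega_pos (m := d - k) (by omega)
  have hL := FlagProj.lintegral_integrand_flagMeasure hkd hP E
  have hmeas := FlagProj.aestronglyMeasurable_integrand hkd E hP
  have hnn := Filter.Eventually.of_forall (f := ae (FlagProj.flagMeasure k P))
    (FlagProj.integrand_nonneg E)
  refine ⟨⟨hmeas, ?_⟩, ?_⟩
  -- Integrability is read off from the formula itself: the compact set `P|E` has finite volume.
  · rw [hasFiniteIntegral_iff_ofReal hnn, hL, FlagProj.euclideanHausdorffMeasure_projection]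
    exact ENNReal.mul_lt_top ENNReal.ofReal_lt_top
      (hP.isCompact.image E.1.orthogonalProjectionOnto.continuous).measure_lt_top
  · rw [integral_eq_lintegral_of_nonneg_ae hnn hmeas, hL, ENNReal.toReal_mul,
      ENNReal.toReal_ofReal hω.le, inv_mul_cancel_left₀ hω.ne']
    rfl
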